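/- All graphs are finite and simple. A graph is \emph{outerplanar} if it has a planar embedding with all vertices on the exterior face (equivalently, it can be drawn with its vertices on a circle and its edges as pairwise non-crossing chords), and \emph{maximal outerplanar} if moreover no edge can be added between existing vertices so that the graph remains outerplanar. Such a graph is considered with a fixed outerplanar embedding. For a graph $G$ and $S\subseteq V(G)$, let $\mathrm{mvc}_S(G)$ be the smallest cardinality of a vertex cover of $G$ that contains $S$, and let $\mathrm{evc}_S(G)$ be the smallest $k$ such that $k$ guards can defend $G$ against every infinite sequence of single-edge attacks while every configuration of the guards occupies a vertex cover that contains $S$. Here, in response to each attack on an edge, each guard stays where it is or moves to an adjacent vertex, and at least one guard moves across the attacked edge. There are two models: either each vertex holds at most one guard in every configuration, or there is no such constraint; the theorem holds in both. We write $\mathrm{mvc}=\mathrm{mvc}_\emptyset$, $\mathrm{evc}=\mathrm{evc}_\emptyset$, $\mathrm{mvc}_{xy}=\mathrm{mvc}_{\{x,y\}}$, and so on. For an edge $xy$ of $G$ let $\mathscr M(G,xy)=(\mathrm{mvc}(G),\mathrm{mvc}_x(G),\mathrm{mvc}_y(G),\mathrm{mvc}_{xy}(G))$ and $\mathscr E(G,xy)=(\mathrm{evc}(G),\mathrm{evc}_x(G),\mathrm{evc}_y(G),\mathrm{evc}_{xy}(G))$.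 \textbf{Theorem.} Let $G$ be a maximal outerplanar graph and let $u$ be a vertex of degree $2$ in $G$ with neighbours $v$ and $w$. Let $G_v$ be the maximal biconnected subgraph of $G$ that has the edge $vw$ on its exterior face and does not contain $u$ (a single edge counts as biconnected; here $G_v$ is the graph $G-u$). Then \[ \mathrm{evc}(G)=\max\{\mathrm{mvc}(G_v)+1,\ \mathrm{evc}_{vw}(G_v)\},\qquad \mathrm{evc}_u(G)=\mathrm{evc}(G_v)+1, \] \[ \mathrm{evc}_{uv}(G)=\mathrm{evc}_v(G_v)+1,\qquad \mathrm{evc}_v(G)=\max\{\mathrm{mvc}_{uv}(G),\ \mathrm{evc}(G)\}. \] Moreover, there are two fixed programs for a unit-cost random access machine and a constant $T$, independent of $G,u,v,w$, the embedding and the guard model, such that: \begin{enumerate} \item given $\mathrm{mvc}(G_v)$ and $\mathscr E(G_v,vw)$, the first program computes $\mathrm{evc}(G)$ in at most $T$ steps; \item given $\mathrm{evc}(G)$, $\mathscr M(G,uv)$ and $\mathscr E(G_v,vw)$, the second program computes the remaining parameters $\mathrm{evc}_u(G)$, $\mathrm{evc}_v(G)$ and $\mathrm{evc}_{uv}(G)$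 in at most $T$ steps. \end{enumerate} -/

import Mathlib

namespace EVC

/-! ### Outerplanar embeddings -/

/-- An outerplanar embedding of `G`: the vertices are placed at distinct points of the unit circle
of the plane `ℂ`, and the edges are drawn as the straight chords between their ends, where the
relative interiors of two different edges are disjoint. The outside of the unit disc is then
contained in the exterior face, so that all vertices lie on the exterior face. -/
structure OuterplanarEmbedding {V : Type*} (G : SimpleGraph V) where
  /-- the position of a vertex -/
  pos : V → ℂ
  pos_injective : Function.Injective pos
  norm_pos : ∀ x, ‖pos x‖ = 1
  noncrossing : ∀ a b c d, G.Adj a b → G.Adj c d → s(a, b) ≠ s(c, d) →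
    Disjoint (openSegment ℝ (pos a) (pos b)) (openSegment ℝ (pos c) (pos d))

/-- A graph is outerplanar if it has an outerplanar embedding. -/
def IsOuterplanar {V : Type*} (G : SimpleGraph V) : Prop :=
  Nonempty (OuterplanarEmbedding G)

/-- A graph is maximal outerplanar if it is outerplanar, and no graph obtained from it by adding
further edges between existing vertices is. -/
def IsMaximalOuterplanar {V : Type*} (G : SimpleGraph V) : Prop :=
  Maximal IsOuterplanar G

namespace OuterplanarEmbedding

variable {V : Type*} {G : SimpleGraph V}

/-- The point set of the plane occupied by the vertices and edges of the subgraph `H`, in the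
drawing of `H` inherited from `G`. -/
def drawing (E : OuterplanarEmbedding G) (H : G.Subgraph) : Set ℂ :=
  {z | ∃ x ∈ H.verts, z = E.pos x} ∪ {z | ∃ x y, H.Adj x y ∧ z ∈ segment ℝ (E.pos x) (E.pos y)}

/-- The exterior face of the drawing of `H`: the union of the unbounded connected components of
the complement (there is exactly one if `G` is finite). -/
def outerFace (E : OuterplanarEmbedding G) (H : G.Subgraph) : Set ℂ :=
  {z | z ∈ (E.drawing H)ᶜ ∧ ¬ Bornology.IsBounded (connectedComponentIn (E.drawing H)ᶜ z)}

/-- `xy` is an edge of `H` that lies on the boundary of the exterior face of the drawing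
of `H`. -/
def IsOuterEdge (E : OuterplanarEmbedding G) (H : G.Subgraph) (x y : V) : Prop :=
  H.Adj x y ∧ segment ℝ (E.pos x) (E.pos y) ⊆ frontier (E.outerFace H)

end OuterplanarEmbedding

/-- `H` is biconnected: it is connected and has no cut vertex. (A single edge is biconnected.) -/
def IsBiconnected {V : Type*} {G : SimpleGraph V} (H : G.Subgraph) : Prop :=
  H.Connected ∧ ∀ x ∈ H.verts, (H.deleteVerts {x}).Preconnected

/-- `H` is the segment `G_v(uv)`, where `uv` is an edge on the exterior face of `G` and `w` is the
common neighbour of `u` and `v`: a maximal one among the biconnected subgraphs of `G` that have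
the edge `vw` on their exterior face and do not contain `u`. (Every subgraph of `G` is outerplanar,
with the inherited embedding.) -/
def IsSegment {V : Type*} {G : SimpleGraph V} (E : OuterplanarEmbedding G) (u v w : V)
    (H : G.Subgraph) : Prop :=
  Maximal (fun K : G.Subgraph => IsBiconnected K ∧ E.IsOuterEdge K v w ∧ u ∉ K.verts) H

/-! ### Vertex covers and eternal vertex covers -/

/-- `mvc_S(G)`: the smallest cardinality of a vertex cover of `G` that contains `S`. -/
noncomputable def mvc {V : Type*} (G : SimpleGraph V) (S : Set V) : ℕ :=
  sInf {k | ∃ C : Set V, G.IsVertexCover C ∧ S ⊆ C ∧ C.ncard = k}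

/-- The two models of the eternal vertex cover problem: in the first, every vertex holds at most
one guard in each configuration; in the second, there is no such constraint. -/
inductive GuardModel where
  | single
  | multiple

/-- The placement `p` of `k` guards on the vertices of `G` is an admissible configuration in
the model `m`, with all vertices of `S` occupied: the occupied vertices form a vertex cover that
contains `S`. -/
def IsConfiguration {V : Type*} (m : GuardModel) (G : SimpleGraph V) (S : Set V) {k : ℕ}
    (p : Fin k → V) : Prop :=
  G.IsVertexCover (Set.range p) ∧ S ⊆ Set.range p ∧
    (m = GuardModel.single → Function.Injective p)

/-- The guards move from `p` to `q` in response to an attack on the edge `e`: each guard stays or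
moves along an edge, and at least one guard moves across `e`. -/
def Defends {V : Type*} (G : SimpleGraph V) {k : ℕ} (e : G.edgeSet) (p q : Fin k → V) : Prop :=
  (∀ i, p i = q i ∨ G.Adj (p i) (q i)) ∧ ∃ i, s(p i, q i) = (e : Sym2 V)

/-- `G` is `k`-defendable with all vertices of `S` occupied in all configurations: there is a
strategy `σ` that assigns to each finite sequence of attacks made so far (latest attack first) the
current configuration, so that any further attack is answered by a legal move. -/
def IsDefendable {V : Type*} (m : GuardModel) (G : SimpleGraph V) (S : Set V) (k : ℕ) : Prop :=
  ∃ σ : List G.edgeSet → (Fin k → V),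
    (∀ h, IsConfiguration m G S (σ h)) ∧ ∀ h e, Defends G e (σ h) (σ (e :: h))

/-- `evc_S(G)` in the model `m`. -/
noncomputable def evc {V : Type*} (m : GuardModel) (G : SimpleGraph V) (S : Set V) : ℕ :=
  sInf {k | IsDefendable m G S k}

/-- `mvc_S(H)` for a subgraph `H` of `G` and a set `S` of vertices of `H`. -/
noncomputable def mvcSub {V : Type*} {G : SimpleGraph V} (H : G.Subgraph) (S : Set V) : ℕ :=
  mvc H.coe (Subtype.val ⁻¹' S)

/-- `evc_S(H)` for a subgraph `H` of `G` and a set `S` of vertices of `H`. -/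
noncomputable def evcSub {V : Type*} {G : SimpleGraph V} (m : GuardModel) (H : G.Subgraph)
    (S : Set V) : ℕ :=
  evc m H.coe (Subtype.val ⁻¹' S)

/-! ### Unit-cost random access machines -/

/-- Instructions of a random access machine whose registers hold natural numbers. -/
inductive Instr where
  /-- `reg d := n` -/
  | const (d n : ℕ)
  /-- `reg d := reg a + reg b` -/
  | add (d a b : ℕ)
  /-- `reg d := reg a - reg b`, truncated at zero -/
  | sub (d a b : ℕ)
  /-- `reg d := reg (reg a)` -/
  | load (d a : ℕ)
  /-- `reg (reg d) := reg a` -/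
  | store (d a : ℕ)
  /-- jump to instruction `l` if `reg a ≤ reg b` -/
  | jumpLE (a b l : ℕ)

/-- The state of a machine: program counter and registers. -/
structure MachineState where
  pc : ℕ
  reg : ℕ → ℕ

/-- The effect of one instruction. -/
def Instr.exec (s : MachineState) : Instr → MachineState
  | .const d n => ⟨s.pc + 1, Function.update s.reg d n⟩
  | .add d a b => ⟨s.pc + 1, Function.update s.reg d (s.reg a + s.reg b)⟩
  | .sub d a b => ⟨s.pc + 1, Function.update s.reg d (s.reg a - s.reg b)⟩
  | .load d a => ⟨s.pc + 1, Function.update s.reg d (s.reg (s.reg a))⟩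
  | .store d a => ⟨s.pc + 1, Function.update s.reg (s.reg d) (s.reg a)⟩
  | .jumpLE a b l => ⟨if s.reg a ≤ s.reg b then l else s.pc + 1, s.reg⟩

/-- One step of the program `P`; the machine has halted if the program counter is beyond the end
of `P`. -/
def machineStep (P : List Instr) (s : MachineState) : MachineState :=
  match P[s.pc]? with
  | none => s
  | some i => i.exec s

/-- The program `P`, started with the numbers `inp` in registers `0, 1, …` and zero in all other
registers, halts after at most `T` steps with the numbers `out` in registers `0, 1, …`. -/
def ComputesWithin (P : List Instr) (T : ℕ) (inp out : List ℕ) : Prop :=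
  ∃ t ≤ T, ∃ s : MachineState, s = (machineStep P)^[t] ⟨0, fun i => inp.getD i 0⟩ ∧
    P.length ≤ s.pc ∧ (List.range out.length).map s.reg = out

end EVC

open EVC

/-!
Call the covers of a graph connected if every vertex cover induces a connected subgraph.

If the covers of `G` are connected and `G` has no isolated vertices, then `evc_S(G)` is the maximum
of `mvc_{S ∪ {x}}(G)` over all vertices `x` (`evc_le_iff`). It is at least this maximum, as an
attack on an edge at `x` forces a configuration that occupies `x`. The maximum is `mvc_S(G)` or
`mvc_S(G) + 1`, and this many guards suffice. In the second case a minimum cover containing `S`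
stays occupied, and one spare guard is moved by shifting guards along a path inside the current
cover. In the first case the configurations are the minimum covers containing `S`. If `x` is
occupied and `y` is not, an attack on `xy` is answered by passing from the current cover `C` to one
of them, `C'`, that contains `y` and is closest to `C`. By Hall's theorem, `C \ C'` without any one
vertex `b` can be matched into `C' \ C` without `y` (`exists_matching_of_closest`), and `b` is
chosen such that a path from `b` to `x` inside `C` avoids the rest of `C \ C'`, so that a shift
along this path and the edge `xy`
withdraws the guard from `b` (`exists_perm_withdraw`).

The covers of a maximal outerplanar graph are connected: in the circular order of the vertices every
edge with vertices beyond it is a side of a triangle on that side, two vertices of which are in the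
cover, and induction applies to the two smaller parts (`IsTriangulation.reachable_between`). The
neighbours `v` and `w` of a vertex `u` of degree two are next to it on the circle, hence adjacent,
and all other vertices are on the other side of the line `vw`. So `vw` is on the exterior face of
`G - u`, whose covers are connected as well (`HasConnectedCovers.deleteVertex`), and `G_v = G - u`
(`OuterplanarEmbedding.structure_of_degree_two`).

The recurrences thereby become statements about vertex covers (`evc_recurrences`). They follow from
`mvc_{S ∪ {u}}(G) = mvc_S(G - u) + 1` and, for `u ∉ S`, from
`mvc_S(G) = mvc_{S ∪ {v, w}}(G - u)`. The programs evaluate their right-hand sides.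
-/

namespace EVC

variable {V : Type*} {G : SimpleGraph V}

/-! ### Vertex covers and walks inside them -/

theorem mvc_le {S C : Set V} (hC : G.IsVertexCover C) (hS : S ⊆ C) : mvc G S ≤ C.ncard :=
  Nat.sInf_le ⟨C, hC, hS, rfl⟩

theorem exists_cover_ncard_eq_mvc (G : SimpleGraph V) (S : Set V) :
    ∃ C : Set V, G.IsVertexCover C ∧ S ⊆ C ∧ C.ncard = mvc G S :=
  Nat.sInf_mem (s := {k | ∃ C : Set V, G.IsVertexCover C ∧ S ⊆ C ∧ C.ncard = k})
    ⟨_, Set.univ, SimpleGraph.isVertexCover_univ, Set.subset_univ _, rfl⟩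

theorem mvc_mono {S T : Set V} (h : S ⊆ T) : mvc G S ≤ mvc G T := by
  obtain ⟨C, hC, hT, hk⟩ := exists_cover_ncard_eq_mvc G T
  exact hk ▸ mvc_le hC (h.trans hT)

theorem mvc_insert_le (x : V) (S : Set V) : mvc G (insert x S) ≤ mvc G S + 1 := by
  obtain ⟨C, hC, hS, hk⟩ := exists_cover_ncard_eq_mvc G S
  calc mvc G (insert x S) ≤ (insert x C).ncard :=
        mvc_le (hC.subset (Set.subset_insert _ _)) (Set.insert_subset_insert hS)
    _ ≤ C.ncard + 1 := Set.ncard_insert_le x C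
    _ = _ := by rw [hk]

/-- Every vertex cover of `G` induces a connected subgraph. -/
def HasConnectedCovers (G : SimpleGraph V) : Prop :=
  ∀ C : Set V, G.IsVertexCover C → (G.induce C).Preconnected

theorem preconnected_induce_iff {C : Set V} :
    (G.induce C).Preconnected ↔
      ∀ x ∈ C, ∀ y ∈ C, ∃ p : G.Walk x y, ∀ a ∈ p.support, a ∈ C := by
  constructor
  · intro h x hx y hy
    obtain ⟨p⟩ := h ⟨x, hx⟩ ⟨y, hy⟩
    let ι : G.induce C →g G := ⟨Subtype.val, id⟩
    refine ⟨p.map ι, fun a ha => ?_⟩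
    obtain ⟨b, -, rfl⟩ := List.mem_map.1 (SimpleGraph.Walk.support_map ι p ▸ ha)
    exact b.2
  · rintro h ⟨x, hx⟩ ⟨y, hy⟩
    obtain ⟨p, hp⟩ := h x hx y hy
    exact ⟨p.induce C hp⟩

/-- A walk that meets `B` has a final part that is a path and meets `B` in its first vertex only. -/
theorem exists_path_from_last {x z : V} (p : G.Walk z x) (B : Set V)
    (h : ∃ b ∈ p.support, b ∈ B) :
    ∃ b ∈ B, ∃ q : G.Walk b x, q.IsPath ∧ ∀ a ∈ q.support, a ∈ p.support ∧ (a ∈ B → a = b) := by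
  classical
  induction p with
  | nil =>
    obtain ⟨b, hb, hB⟩ := h
    simp only [SimpleGraph.Walk.support_nil, List.mem_singleton] at hb
    subst hb
    exact ⟨b, hB, .nil, .nil, by simp⟩
  | @cons z c x hzc p ih =>
    by_cases h' : ∃ b ∈ p.support, b ∈ B
    · obtain ⟨b, hb, q, hq, hs⟩ := ih h'
      exact ⟨b, hb, q, hq, fun a ha => ⟨List.mem_cons_of_mem _ (hs a ha).1, (hs a ha).2⟩⟩
    · push Not at h'
      obtain ⟨b, hb, hB⟩ := h
      obtain rfl : b = z := by
        rcases List.mem_cons.1 hb with h | h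
        · exact h
        · exact absurd hB (h' b h)
      refine ⟨b, hB, (SimpleGraph.Walk.cons hzc p).bypass,
        SimpleGraph.Walk.bypass_isPath _, fun a ha => ?_⟩
      have ha' := SimpleGraph.Walk.support_bypass_subset_support _ ha
      refine ⟨ha', fun haB => ?_⟩
      rcases List.mem_cons.1 ha' with h | h
      · exact h
      · exact absurd haB (h' a h)

/-- Along a path from `b` to `x` followed by the edge `xy`, every guard advances one step. The
moves extend to a cyclic permutation of the vertices of the path and `y`. -/
theorem exists_perm_shift [DecidableEq V] {b x y : V} (q : G.Walk b x) (hq : q.IsPath)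
    (hxy : G.Adj x y) (hy : y ∉ q.support) :
    ∃ φ : Equiv.Perm V, φ x = y ∧ φ y = b ∧ (∀ a ∈ q.support, G.Adj a (φ a)) ∧
      ∀ a ∉ q.support, a ≠ y → φ a = a := by
  induction q with
  | @nil z =>
    refine ⟨Equiv.swap z y, by simp, by simp, by simpa using hxy, fun a ha hay => ?_⟩
    exact Equiv.swap_apply_of_ne_of_ne (by simpa using ha) hay
  | @cons z c x hzc p ih =>
    rw [SimpleGraph.Walk.cons_isPath_iff] at hq
    rw [SimpleGraph.Walk.support_cons, List.mem_cons, not_or] at hy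
    obtain ⟨φ, h1, h2, h3, h4⟩ := ih hq.1 hxy hy.2
    have hz : φ z = z := h4 z hq.2 (Ne.symm hy.1)
    have key : ∀ a, a ≠ z → a ≠ y → (φ * Equiv.swap z y) a = φ a := fun a h h' => by
      rw [Equiv.Perm.mul_apply, Equiv.swap_apply_of_ne_of_ne h h']
    have hne : ∀ a ∈ p.support, a ≠ z ∧ a ≠ y := fun a ha =>
      ⟨fun h => hq.2 (h ▸ ha), fun h => hy.2 (h ▸ ha)⟩
    refine ⟨φ * Equiv.swap z y, ?_, ?_, ?_, ?_⟩
    · have := hne x p.end_mem_support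
      rw [key x this.1 this.2, h1]
    · simp [hz]
    · intro a ha
      rcases List.mem_cons.1 ha with rfl | ha
      · simpa [h2] using hzc
      · rw [key a (hne a ha).1 (hne a ha).2]
        exact h3 a ha
    · intro a ha hay
      rw [SimpleGraph.Walk.support_cons, List.mem_cons, not_or] at ha
      rw [key a ha.1 hay, h4 a ha.2 hay]

/-- In a connected cover `C`, one guard of any nonempty part `B` of `C` can be withdrawn in favour
of a vertex `y` outside `C`, in such a way that a prescribed guard `x` is the one that enters `y`
and all other guards of `B` stay in place. -/
theorem exists_perm_withdraw {C B : Set V} (hC : (G.induce C).Preconnected) (hBC : B ⊆ C)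
    (hB : B.Nonempty) {x y : V} (hx : x ∈ C) (hy : y ∉ C) (hxy : G.Adj x y) :
    ∃ b ∈ B, ∃ φ : Equiv.Perm V, φ x = y ∧ φ y = b ∧ (∀ a ∈ C, a = φ a ∨ G.Adj a (φ a)) ∧
      (∀ a ∈ B, a ≠ b → φ a = a) ∧ ∀ a ∉ C, a ≠ y → φ a = a := by
  classical
  obtain ⟨z, hz⟩ := hB
  obtain ⟨p, hp⟩ := preconnected_induce_iff.1 hC z (hBC hz) x hx
  obtain ⟨b, hb, q, hq, hs⟩ := exists_path_from_last p B ⟨z, p.start_mem_support, hz⟩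
  have hsC : ∀ a ∈ q.support, a ∈ C := fun a ha => hp a (hs a ha).1
  obtain ⟨φ, h1, h2, h3, h4⟩ := exists_perm_shift q hq hxy (fun h => hy (hsC y h))
  refine ⟨b, hb, φ, h1, h2, fun a ha => ?_, fun a ha hab => ?_, fun a ha hay => ?_⟩
  · by_cases h : a ∈ q.support
    · exact .inr (h3 a h)
    · exact .inl (h4 a h (fun h => hy (h ▸ ha))).symm
  · exact h4 a (fun h => hab ((hs a h).2 ha)) (fun h => hy (h ▸ hBC ha))
  · exact h4 a (fun h => ha (hsC a h)) hay

/-! ### Strategies -/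

/-- A family `P` of covers of the same size is a strategy if the guards can pass from each member
`C` to another one in response to an attack on an edge with exactly one end in `C`. (An attack on
an edge with both ends in `C` is answered by an exchange of two guards.) Every vertex holds at most
one guard throughout, so the strategy serves in both models. -/
theorem isDefendable_of_response [Finite V] (m : GuardModel) {S : Set V} {k : ℕ}
    (P : Set V → Prop) (hne : ∃ C, P C)
    (hP : ∀ C, P C → G.IsVertexCover C ∧ S ⊆ C ∧ C.ncard = k)
    (hstep : ∀ C, P C → ∀ x y, G.Adj x y → x ∈ C → y ∉ C → ∃ ψ : V → V, Set.InjOn ψ C ∧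
      P (ψ '' C) ∧ ψ x = y ∧ ∀ a ∈ C, a = ψ a ∨ G.Adj a (ψ a)) :
    IsDefendable m G S k := by
  classical
  let Q := {p : Fin k → V // Function.Injective p ∧ P (Set.range p)}
  have hQ : ∀ p : Q, IsConfiguration m G S p.1 := fun p =>
    ⟨(hP _ p.2.2).1, (hP _ p.2.2).2.1, fun _ => p.2.1⟩
  have hstart : Nonempty Q := by
    obtain ⟨C, hC⟩ := hne
    have hcard := (hP C hC).2.2
    let e : C ≃ Fin k := Finite.equivFinOfCardEq (by rw [Nat.card_coe_set_eq, hcard])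
    refine ⟨⟨fun i => (e.symm i : V), Subtype.val_injective.comp e.symm.injective, ?_⟩⟩
    have : Set.range (fun i => (e.symm i : V)) = C := by
      rw [show (fun i => (e.symm i : V)) = Subtype.val ∘ e.symm from rfl, Set.range_comp,
        e.symm.surjective.range_eq, Set.image_univ, Subtype.range_coe]
    rwa [this]
  -- a map `ψ` on the occupied set is a move of the guards
  have move : ∀ (p : Q) (ψ : V → V) (x y : V), Set.InjOn ψ (Set.range p.1) →
      P (ψ '' Set.range p.1) → (∀ a ∈ Set.range p.1, a = ψ a ∨ G.Adj a (ψ a)) →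
      x ∈ Set.range p.1 → ψ x = y → ∀ h : s(x, y) ∈ G.edgeSet,
      ∃ q : Q, Defends G ⟨s(x, y), h⟩ p.1 q.1 := by
    intro p ψ x y hinj hψ hmv hx hxy h
    refine ⟨⟨ψ ∘ p.1, fun i j hij => p.2.1 (hinj ⟨i, rfl⟩ ⟨j, rfl⟩ hij), ?_⟩,
      fun i => hmv _ ⟨i, rfl⟩, ?_⟩
    · rwa [Set.range_comp]
    · obtain ⟨i, rfl⟩ := hx
      exact ⟨i, by simp [hxy]⟩
  have resp : ∀ (p : Q) (e : G.edgeSet), ∃ q : Q, Defends G e p.1 q.1 := by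
    rintro p ⟨e, he⟩
    obtain ⟨x, y, rfl, hx⟩ : ∃ x y, e = s(x, y) ∧ x ∈ Set.range p.1 := by
      induction e with
      | _ x y =>
        rcases (hP _ p.2.2).1 (G.mem_edgeSet.1 he) with h | h
        · exact ⟨x, y, rfl, h⟩
        · exact ⟨y, x, Sym2.eq_swap, h⟩
    have hxy : G.Adj x y := he
    by_cases hy : y ∈ Set.range p.1
    · refine move p (Equiv.swap x y) x y (Equiv.injective _).injOn ?_ ?_ hx (by simp) he
      · have : Equiv.swap x y '' Set.range p.1 = Set.range p.1 := by
          ext a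
          rw [Equiv.image_eq_preimage_symm, Set.mem_preimage, Equiv.symm_swap,
            Equiv.swap_apply_def]
          split_ifs with h1 h2
          · subst h1; simp only [hx, hy]
          · subst h2; simp only [hx, hy]
          · rfl
        rw [this]
        exact p.2.2
      · intro a _
        rw [Equiv.swap_apply_def]
        split_ifs with h1 h2
        · exact .inr (h1 ▸ hxy)
        · exact .inr (h2 ▸ hxy.symm)
        · exact .inl rfl
    · obtain ⟨ψ, h1, h2, h3, h4⟩ := hstep _ p.2.2 x y hxy hx hy
      exact move p ψ x y h1 h2 h4 hx h3 he
  choose r hr using resp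
  let σ : List G.edgeSet → Q := fun h => h.foldr (fun e p => r p e) hstart.some
  exact ⟨fun h => (σ h).1, fun h => hQ _, fun h e => hr (σ h) e⟩

/-- If some vertex is in no minimum cover containing `S`, one more guard than in a minimum cover
suffices: a minimum cover `M` stays occupied, and the spare guard is moved around. -/
theorem isDefendable_mvc_add_one [Finite V] (m : GuardModel) (hG : HasConnectedCovers G)
    {S : Set V} {x₀ : V} (hx₀ : mvc G S < mvc G (insert x₀ S)) :
    IsDefendable m G S (mvc G S + 1) := by
  classical
  obtain ⟨M, hM, hS, hk⟩ := exists_cover_ncard_eq_mvc G S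
  have hx₀M : x₀ ∉ M := fun h => by
    have := mvc_le hM (Set.insert_subset h hS)
    omega
  refine isDefendable_of_response m
    (fun C => ∃ z ∉ M, C = insert z M) ⟨_, x₀, hx₀M, rfl⟩ ?_ ?_
  · rintro _ ⟨z, hz, rfl⟩
    exact ⟨hM.subset (Set.subset_insert _ _), hS.trans (Set.subset_insert _ _),
      by rw [Set.ncard_insert_of_notMem hz, hk]⟩
  · rintro _ ⟨z, hz, rfl⟩ x y hxy hx hy
    have hC : G.IsVertexCover (insert z M) := hM.subset (Set.subset_insert _ _)
    obtain ⟨b, hb, φ, h1, h2, h3, -, h5⟩ := exists_perm_withdraw (hG _ hC)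
      (B := {z}) (by simp) (by simp) hx hy hxy
    obtain rfl : b = z := hb
    rw [Set.mem_insert_iff, not_or] at hy
    refine ⟨φ, φ.injective.injOn, ⟨y, hy.2, ?_⟩, h1, h3⟩
    have hsub : φ '' insert b M ⊆ insert y M := by
      rintro _ ⟨a, ha, rfl⟩
      by_contra hna
      rw [Set.mem_insert_iff, not_or] at hna
      have hbφ : φ a ≠ b := fun h => by
        have : a = y := φ.injective (h.trans h2.symm)
        subst this
        exact ha.elim (fun h => hy.1 h) hy.2
      have := φ.injective (h5 (φ a) (by simp [hbφ, hna.2]) hna.1)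
      rw [this] at hna hbφ
      exact ha.elim hbφ hna.2
    refine Set.eq_of_subset_of_ncard_le hsub ?_
    rw [Set.ncard_image_of_injective _ φ.injective, Set.ncard_insert_of_notMem hz,
      Set.ncard_insert_of_notMem hy.2]

/-- Let `C` and `C'` be minimum covers containing `S`, where `C'` is chosen closest to `C` among
those that contain `y`. Then after the removal of `y` from `C' \ C` and of any vertex `b` from
`C \ C'` there is a perfect matching between these sets: a violation of Hall's condition would
allow a part of `C'` to be exchanged for a part of `C`. -/
theorem exists_matching_of_closest [DecidableEq V] {S : Set V} {C C' : Finset V}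
    (hC : G.IsVertexCover (C : Set V)) (hC' : G.IsVertexCover (C' : Set V))
    (hSC : S ⊆ C) (hSC' : S ⊆ C') (hk : C.card = mvc G S) (hk' : C'.card = mvc G S)
    {y : V} (hyC : y ∉ C) (hyC' : y ∈ C')
    (hmin : ∀ D : Finset V, G.IsVertexCover (D : Set V) → S ⊆ D → D.card = mvc G S → y ∈ D →
      (C' \ C).card ≤ (D \ C).card) {b : V} (hb : b ∈ C \ C') :
    ∃ f : ((C \ C').erase b : Finset V) → V, Function.Injective f ∧
      ∀ a, f a ∈ (C' \ C).erase y ∧ G.Adj a (f a) := by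
  classical
  have hy : y ∈ C' \ C := Finset.mem_sdiff.2 ⟨hyC', hyC⟩
  have hAB : (C' \ C).card = (C \ C').card := Finset.card_sdiff_comm (hk'.trans hk.symm)
  let t : ((C \ C').erase b : Finset V) → Finset V := fun a =>
    ((C' \ C).erase y).filter (fun c => G.Adj a c)
  obtain ⟨f, hf, hft⟩ := (Finset.all_card_le_biUnion_card_iff_exists_injective t).1 (by
    intro s
    -- `D` consists of the vertices that the part `B'` of `C \ C'` does not reach
    let B' : Finset V := s.map (Function.Embedding.subtype _)
    have hB'card : B'.card = s.card := Finset.card_map _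
    have hB' : B' ⊆ (C \ C').erase b := by
      intro a ha
      obtain ⟨a', -, rfl⟩ := Finset.mem_map.1 ha
      exact a'.2
    have hB'' : B' ⊆ C \ C' := hB'.trans (Finset.erase_subset _ _)
    let D : Finset V := (C' \ C).erase y \ s.biUnion t
    have hDA : D ⊆ (C' \ C).erase y := Finset.sdiff_subset
    have hN : s.biUnion t ⊆ (C' \ C).erase y :=
      Finset.biUnion_subset.2 fun a _ => Finset.filter_subset _ _
    have hDcard : D.card + (s.biUnion t).card = ((C' \ C).erase y).card := by
      rw [Finset.card_sdiff_of_subset hN]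
      have := Finset.card_le_card hN
      omega
    have hAcard : ((C' \ C).erase y).card + 1 = (C' \ C).card :=
      Finset.card_erase_add_one hy
    have hDB : ∀ d ∈ D, ∀ c ∈ B', ¬ G.Adj c d := by
      intro d hd c hc hadj
      obtain ⟨c', hc', rfl⟩ := Finset.mem_map.1 hc
      exact (Finset.mem_sdiff.1 hd).2 (Finset.mem_biUnion.2
        ⟨c', hc', Finset.mem_filter.2 ⟨hDA hd, hadj⟩⟩)
    rw [← hB'card]
    by_cases hD : D = ∅
    · have h1 := Finset.card_le_card hB'
      rw [Finset.card_erase_of_mem hb] at h1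
      rw [hD, Finset.card_empty] at hDcard
      omega
    -- the exchange
    let E : Finset V := (C' \ D) ∪ ((C \ C') \ B')
    have hDC' : D ⊆ C' := fun d hd => (Finset.mem_sdiff.1 (Finset.erase_subset _ _ (hDA hd))).1
    have hDC : ∀ d ∈ D, d ∉ C := fun d hd =>
      (Finset.mem_sdiff.1 (Finset.erase_subset _ _ (hDA hd))).2
    have hyD : y ∉ D := fun h => Finset.notMem_erase y _ (hDA h)
    have hEcover : G.IsVertexCover (E : Set V) := by
      have key : ∀ p q, G.Adj p q → p ∈ C' → p ∈ E ∨ q ∈ E := by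
        intro p q hpq hp
        by_cases hpD : p ∈ D
        · right
          have hqC : q ∈ C := (hC hpq).resolve_left (hDC p hpD)
          have hqD : q ∉ D := fun h => hDC q h hqC
          have hqB : q ∉ B' := fun h => hDB p hpD q h hpq.symm
          by_cases hqC' : q ∈ C'
          · exact Finset.mem_union_left _ (Finset.mem_sdiff.2 ⟨hqC', hqD⟩)
          · exact Finset.mem_union_right _ (Finset.mem_sdiff.2
              ⟨Finset.mem_sdiff.2 ⟨hqC, hqC'⟩, hqB⟩)
        · exact .inl (Finset.mem_union_left _ (Finset.mem_sdiff.2 ⟨hp, hpD⟩))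
      intro p q hpq
      rcases hC' hpq with h | h
      · exact key p q hpq h
      · exact (key q p hpq.symm h).symm
    have hES : S ⊆ E := fun c hc => Finset.mem_coe.2 (Finset.mem_union_left _
      (Finset.mem_sdiff.2 ⟨hSC' hc, fun h => hDC c h (hSC hc)⟩))
    have hEcard : E.card + D.card + B'.card = mvc G S + (C \ C').card := by
      have hdisj : Disjoint (C' \ D) ((C \ C') \ B') := by
        rw [Finset.disjoint_left]
        intro c hc hc'
        exact (Finset.mem_sdiff.1 (Finset.mem_sdiff.1 hc').1).2 (Finset.mem_sdiff.1 hc).1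
      rw [Finset.card_union_of_disjoint hdisj, Finset.card_sdiff_of_subset hDC',
        Finset.card_sdiff_of_subset hB'']
      have := Finset.card_le_card hDC'
      have := Finset.card_le_card hB''
      omega
    have hEk : mvc G S ≤ E.card := by
      have := mvc_le hEcover hES
      rwa [Set.ncard_coe_finset] at this
    have hne : E.card ≠ mvc G S := by
      intro h
      have h1 := hmin E hEcover hES h
        (Finset.mem_union_left _ (Finset.mem_sdiff.2 ⟨hyC', hyD⟩))
      have h2 : E \ C ⊂ C' \ C := by
        rw [Finset.ssubset_iff_subset_ne]
        constructor
        · intro c hc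
          obtain ⟨hcE, hcC⟩ := Finset.mem_sdiff.1 hc
          rcases Finset.mem_union.1 hcE with h | h
          · exact Finset.mem_sdiff.2 ⟨(Finset.mem_sdiff.1 h).1, hcC⟩
          · exact absurd (Finset.mem_sdiff.1 (Finset.mem_sdiff.1 h).1).1 hcC
        · intro heq
          obtain ⟨d, hd⟩ := Finset.nonempty_iff_ne_empty.2 hD
          have : d ∈ E \ C := heq ▸ Finset.mem_sdiff.2 ⟨hDC' hd, hDC d hd⟩
          rcases Finset.mem_union.1 (Finset.mem_sdiff.1 this).1 with h | h
          · exact (Finset.mem_sdiff.1 h).2 hd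
          · exact hDC d hd (Finset.mem_sdiff.1 (Finset.mem_sdiff.1 h).1).1
      exact absurd (Finset.card_lt_card h2) (by omega)
    omega)
  exact ⟨f, hf, fun a => ⟨Finset.filter_subset _ _ (hft a), (Finset.mem_filter.1 (hft a)).2⟩⟩

/-- If every vertex is in some minimum cover containing `S`, the minimum covers containing `S`
form a strategy. -/
theorem isDefendable_mvc [Finite V] (m : GuardModel) (hG : HasConnectedCovers G)
    {S : Set V} (hS : ∀ x, mvc G (insert x S) = mvc G S) :
    IsDefendable m G S (mvc G S) := by
  classical
  have := Fintype.ofFinite V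
  refine isDefendable_of_response m
    (fun C => G.IsVertexCover C ∧ S ⊆ C ∧ C.ncard = mvc G S)
    (exists_cover_ncard_eq_mvc G S) (fun _ h => h) ?_
  rintro C₀ ⟨hC, hSC, hk⟩ x y hxy hx hy
  obtain ⟨C, rfl⟩ : ∃ C : Finset V, (C : Set V) = C₀ := ⟨C₀.toFinset, by simp⟩
  rw [Set.ncard_coe_finset] at hk
  rw [Finset.mem_coe] at hx hy
  obtain ⟨C', ⟨hC', hSC', hk', hyC'⟩, hmin⟩ : ∃ C' : Finset V, (G.IsVertexCover (C' : Set V) ∧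
      S ⊆ C' ∧ C'.card = mvc G S ∧ y ∈ C') ∧ ∀ D : Finset V, G.IsVertexCover (D : Set V) →
      S ⊆ D → D.card = mvc G S → y ∈ D → (C' \ C).card ≤ (D \ C).card := by
    obtain ⟨C', hC', hmin⟩ := Finset.exists_min_image
      (Finset.univ.filter fun D : Finset V => G.IsVertexCover (D : Set V) ∧
        S ⊆ D ∧ D.card = mvc G S ∧ y ∈ D) (fun D => (D \ C).card) (by
          obtain ⟨D, h1, h2, h3⟩ := exists_cover_ncard_eq_mvc G (insert y S)
          rw [hS] at h3
          refine ⟨D.toFinset, ?_⟩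
          rw [Finset.mem_filter]
          refine ⟨Finset.mem_univ _, by simpa using h1, ?_, ?_, ?_⟩
          · simpa using (Set.subset_insert _ _).trans h2
          · rw [← h3, Set.ncard_eq_toFinset_card']
          · simpa using h2 (Set.mem_insert _ _))
    refine ⟨C', (Finset.mem_filter.1 hC').2, fun D h1 h2 h3 h4 => hmin D ?_⟩
    exact Finset.mem_filter.2 ⟨Finset.mem_univ _, h1, h2, h3, h4⟩
  have hAB : (C' \ C).card = (C \ C').card := Finset.card_sdiff_comm (hk'.trans hk.symm)
  have hBne : ((C \ C' : Finset V) : Set V).Nonempty := by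
    rw [Finset.coe_nonempty, ← Finset.card_pos, ← hAB, Finset.card_pos]
    exact ⟨y, Finset.mem_sdiff.2 ⟨hyC', hy⟩⟩
  obtain ⟨b, hb, φ, h1, h2, h3, h4, h5⟩ := exists_perm_withdraw (hG _ hC)
    (B := ((C \ C' : Finset V) : Set V)) (by simp) hBne hx hy hxy
  rw [Finset.mem_coe] at hb
  obtain ⟨f, hf, hfA⟩ := exists_matching_of_closest hC hC' hSC hSC' hk hk' hy hyC' hmin hb
  -- the guards of `C \ C'` other than `b` follow the matching, the others follow `φ`
  let ψ : V → V := fun a => if h : a ∈ (C \ C').erase b then f ⟨a, h⟩ else φ a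
  have hψ1 : ∀ a (h : a ∈ (C \ C').erase b), ψ a = f ⟨a, h⟩ := fun a h => dif_pos h
  have hψ2 : ∀ a, a ∉ (C \ C').erase b → ψ a = φ a := fun a h => dif_neg h
  have hφ : ∀ a ∈ C, a ∉ (C \ C').erase b → φ a = y ∨ φ a ∈ C ∩ C' := by
    intro a ha hab
    by_contra! hcon
    obtain ⟨hne, hmem⟩ := hcon
    by_cases hφC : φ a ∈ C
    · have hφB : φ a ∈ C \ C' := by
        rw [Finset.mem_inter, not_and] at hmem
        exact Finset.mem_sdiff.2 ⟨hφC, hmem hφC⟩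
      by_cases hφb : φ a = b
      · exact hy (φ.injective (hφb.trans h2.symm) ▸ ha)
      · have := φ.injective (h4 _ hφB hφb)
        rw [this] at hφB hφb
        exact hab (Finset.mem_erase.2 ⟨hφb, hφB⟩)
    · have := φ.injective (h5 _ hφC hne)
      rw [this] at hφC
      exact hφC ha
  have hφA : ∀ a ∈ C, a ∉ (C \ C').erase b → φ a ∉ (C' \ C).erase y := by
    intro a ha hab hA
    rcases hφ a ha hab with h | h
    · exact Finset.ne_of_mem_erase hA h
    · exact (Finset.mem_sdiff.1 (Finset.mem_of_mem_erase hA)).2 (Finset.mem_inter.1 h).1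
  have hinj : Set.InjOn ψ (C : Set V) := by
    intro a ha c hc hac
    by_cases h : a ∈ (C \ C').erase b <;> by_cases h' : c ∈ (C \ C').erase b
    · rw [hψ1 a h, hψ1 c h'] at hac
      exact congrArg Subtype.val (hf hac)
    · rw [hψ1 a h, hψ2 c h'] at hac
      exact absurd (hac ▸ (hfA ⟨a, h⟩).1) (hφA c hc h')
    · rw [hψ2 a h, hψ1 c h'] at hac
      exact absurd (hac ▸ (hfA ⟨c, h'⟩).1) (hφA a ha h)
    · rw [hψ2 a h, hψ2 c h'] at hac
      exact φ.injective hac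
  have himage : ψ '' (C : Set V) = C' := by
    refine Set.eq_of_subset_of_ncard_le ?_ ?_
    · rintro _ ⟨a, ha, rfl⟩
      by_cases h : a ∈ (C \ C').erase b
      · rw [hψ1 a h]
        exact (Finset.mem_sdiff.1 (Finset.mem_of_mem_erase (hfA ⟨a, h⟩).1)).1
      · rw [hψ2 a h]
        rcases hφ a ha h with h | h
        · rw [h]; exact hyC'
        · exact (Finset.mem_inter.1 h).2
    · rw [hinj.ncard_image, Set.ncard_coe_finset, Set.ncard_coe_finset, hk, hk']
  have hxb : x ∉ (C \ C').erase b := fun h => by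
    have := h4 x (Finset.mem_coe.2 (Finset.mem_of_mem_erase h)) (Finset.ne_of_mem_erase h)
    exact hxy.ne (this ▸ h1)
  refine ⟨ψ, hinj, ?_, by rw [hψ2 x hxb, h1], fun a ha => ?_⟩
  · rw [himage, Set.ncard_coe_finset]
    exact ⟨hC', hSC', hk'⟩
  · by_cases h : a ∈ (C \ C').erase b
    · rw [hψ1 a h]
      exact .inr (hfA ⟨a, h⟩).2
    · rw [hψ2 a h]
      exact h3 a ha

/-! ### The eternal vertex cover number when all covers are connected -/

/-- An attack on an edge at `x` forces a configuration that occupies `x`, before or after the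
response. -/
theorem IsDefendable.mvc_insert_le {m : GuardModel} {S : Set V} {k : ℕ}
    (h : IsDefendable m G S k) {x y : V} (hxy : G.Adj x y) : mvc G (insert x S) ≤ k := by
  obtain ⟨σ, hσ, hd⟩ := h
  have key : ∀ h, x ∈ Set.range (σ h) → mvc G (insert x S) ≤ k := fun h hx =>
    calc mvc G (insert x S) ≤ (Set.range (σ h)).ncard :=
          mvc_le (hσ h).1 (Set.insert_subset hx (hσ h).2.1)
      _ = (σ h '' Set.univ).ncard := by rw [Set.image_univ]
      _ ≤ (Set.univ : Set (Fin k)).ncard := Set.ncard_image_le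
      _ = k := by simp
  obtain ⟨-, i, hi⟩ := hd [] ⟨s(x, y), hxy⟩
  rcases Sym2.eq_iff.1 hi with ⟨h, -⟩ | ⟨-, h⟩
  · exact key _ ⟨i, h⟩
  · exact key _ ⟨i, h⟩

/-- If all covers of `G` are connected, then `evc_S(G)` is the largest of the numbers
`mvc_{S ∪ {x}}(G)`, in both guard models. -/
theorem evc_le_iff [Finite V] [Nonempty V] (m : GuardModel) (hG : HasConnectedCovers G)
    (hdeg : ∀ x, ∃ y, G.Adj x y) (S : Set V) (k : ℕ) :
    evc m G S ≤ k ↔ ∀ x, mvc G (insert x S) ≤ k := by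
  obtain ⟨x₀, hx₀⟩ : ∃ x₀, IsDefendable m G S (mvc G (insert x₀ S)) := by
    by_cases h : ∀ x, mvc G (insert x S) = mvc G S
    · obtain ⟨x⟩ := ‹Nonempty V›
      exact ⟨x, by rw [h x]; exact isDefendable_mvc m hG h⟩
    · push Not at h
      obtain ⟨x, hx⟩ := h
      have hlt := lt_of_le_of_ne (mvc_mono (G := G) (Set.subset_insert x S)) hx.symm
      have hle := EVC.mvc_insert_le (G := G) x S
      exact ⟨x, by rw [show mvc G (insert x S) = mvc G S + 1 by omega]
                   exact isDefendable_mvc_add_one m hG hlt⟩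
  constructor
  · intro h x
    obtain ⟨y, hy⟩ := hdeg x
    have : IsDefendable m G S (evc m G S) := Nat.sInf_mem (s := {k | IsDefendable m G S k}) ⟨_, hx₀⟩
    exact (this.mvc_insert_le hy).trans h
  · intro h
    exact (Nat.sInf_le (s := {k | IsDefendable m G S k}) hx₀).trans (h x₀)

/-! ### Removal of a vertex -/

/-- The subgraph `G - u`. -/
abbrev deleteVertex (G : SimpleGraph V) (u : V) : G.Subgraph :=
  (⊤ : G.Subgraph).deleteVerts {u}

theorem mem_verts_deleteVertex {u x : V} : x ∈ (deleteVertex G u).verts ↔ x ≠ u := by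
  simp

theorem deleteVertex_adj {u x y : V} :
    (deleteVertex G u).Adj x y ↔ G.Adj x y ∧ x ≠ u ∧ y ≠ u := by
  rw [SimpleGraph.Subgraph.deleteVerts_adj]
  simp
  tauto

theorem mvcSub_deleteVertex_le {u : V} {S C : Set V}
    (hC : ∀ x y, G.Adj x y → x ≠ u → y ≠ u → x ∈ C ∨ y ∈ C) (hS : S \ {u} ⊆ C) :
    mvcSub (deleteVertex G u) S ≤ (C \ {u}).ncard := by
  have h : (Subtype.val ⁻¹' C : Set (deleteVertex G u).verts).ncard = (C \ {u}).ncard := by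
    rw [← Set.ncard_image_of_injective _ Subtype.val_injective, Subtype.image_preimage_coe]
    congr 1
    ext x
    simp [and_comm]
  rw [← h]
  refine mvc_le ?_ ?_
  · rintro ⟨x, hx⟩ ⟨y, hy⟩ hxy
    have := deleteVertex_adj.1 hxy
    exact hC x y this.1 this.2.1 this.2.2
  · rintro ⟨x, hx⟩ hxS
    exact hS ⟨hxS, mem_verts_deleteVertex.1 hx⟩

theorem exists_cover_ncard_eq_mvcSub (G : SimpleGraph V) (u : V) (S : Set V) :
    ∃ C : Set V, u ∉ C ∧ (∀ x y, G.Adj x y → x ≠ u → y ≠ u → x ∈ C ∨ y ∈ C) ∧ S \ {u} ⊆ C ∧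
      C.ncard = mvcSub (deleteVertex G u) S := by
  obtain ⟨D, hD, hS, hk⟩ :=
    exists_cover_ncard_eq_mvc (deleteVertex G u).coe (Subtype.val ⁻¹' S)
  have hmem : ∀ x (hx : x ∈ (deleteVertex G u).verts), (⟨x, hx⟩ : (deleteVertex G u).verts) ∈ D →
      x ∈ Subtype.val '' D := fun x hx h => ⟨_, h, rfl⟩
  refine ⟨Subtype.val '' D, ?_, fun x y hxy hx hy => ?_, fun x hx => ?_, ?_⟩
  · rintro ⟨x, -, hx⟩
    exact mem_verts_deleteVertex.1 x.2 hx
  · have h : (deleteVertex G u).coe.Adj ⟨x, mem_verts_deleteVertex.2 hx⟩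
        ⟨y, mem_verts_deleteVertex.2 hy⟩ := deleteVertex_adj.2 ⟨hxy, hx, hy⟩
    exact (hD h).imp (hmem _ _) (hmem _ _)
  · exact hmem x (mem_verts_deleteVertex.2 hx.2) (hS hx.1)
  · rw [Set.ncard_image_of_injective _ Subtype.val_injective, hk, mvcSub]

theorem mvcSub_deleteVertex_mono {u : V} {S T : Set V} (h : S \ {u} ⊆ T) :
    mvcSub (deleteVertex G u) S ≤ mvcSub (deleteVertex G u) T :=
  mvc_mono fun x hx => h ⟨hx, mem_verts_deleteVertex.1 x.2⟩

/-- A cover of `G` that contains `u` consists of `u` and a cover of `G - u`. -/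
theorem mvc_insert_eq [Finite V] (u : V) (S : Set V) :
    mvc G (insert u S) = mvcSub (deleteVertex G u) S + 1 := by
  apply le_antisymm
  · obtain ⟨C, hu, hC, hS, hk⟩ := exists_cover_ncard_eq_mvcSub G u S
    rw [← hk, ← Set.ncard_insert_of_notMem hu]
    refine mvc_le (fun x y hxy => ?_) (fun x hx => ?_)
    · by_cases hx : x = u
      · exact .inl (.inl hx)
      · by_cases hy : y = u
        · exact .inr (.inl hy)
        · exact (hC x y hxy hx hy).imp .inr .inr
    · by_cases hxu : x = u
      · exact .inl hxu
      · exact .inr (hS ⟨hx.resolve_left hxu, hxu⟩)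
  · obtain ⟨C, hC, hS, hk⟩ := exists_cover_ncard_eq_mvc G (insert u S)
    rw [← hk, ← Set.ncard_sdiff_singleton_add_one (hS (Set.mem_insert u S))]
    exact Nat.add_le_add_right (mvcSub_deleteVertex_le (fun x y h _ _ => hC h)
      (fun x hx => hS (.inr hx.1))) 1

/-- If the neighbours of `u` are the adjacent vertices `v` and `w`, a minimum cover of `G` may be
taken to avoid `u` and hence to contain `v` and `w`: a cover that contains `u` contains `v` or `w`
as well, and `u` can be replaced by the other one. -/
theorem mvc_eq_mvcSub [Finite V] {u v w : V} (hu : G.neighborSet u = {v, w}) (hvw : G.Adj v w)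
    {S : Set V} (hS : u ∉ S) : mvc G S = mvcSub (deleteVertex G u) (S ∪ {v, w}) := by
  have huv : G.Adj u v := (Set.ext_iff.1 hu v).2 (by simp)
  have huw : G.Adj u w := (Set.ext_iff.1 hu w).2 (by simp)
  have hnb : ∀ x, G.Adj u x → x = v ∨ x = w := fun x hx => (Set.ext_iff.1 hu x).1 hx
  apply le_antisymm
  · obtain ⟨C, -, hC, hSC, hk⟩ := exists_cover_ncard_eq_mvcSub G u (S ∪ {v, w})
    have hnC : ∀ x, G.Adj u x → x ∈ C := fun x hx =>
      hSC ⟨.inr (hnb x hx), hx.ne'⟩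
    rw [← hk]
    refine mvc_le (fun x y hxy => ?_) (fun x hx => hSC ⟨.inl hx, fun h => hS (h ▸ hx)⟩)
    by_cases hx : x = u
    · exact .inr (hnC y (hx ▸ hxy))
    · by_cases hy : y = u
      · exact .inl (hnC x (hy ▸ hxy.symm))
      · exact hC x y hxy hx hy
  · obtain ⟨C, hC, hSC, hk⟩ := exists_cover_ncard_eq_mvc G S
    rw [← hk]
    have key : ∀ a b, G.Adj u a → G.Adj u b → ({v, w} : Set V) = {a, b} → a ∈ C →
        mvcSub (deleteVertex G u) (S ∪ {v, w}) ≤ C.ncard := by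
      intro a b hua hub hab ha
      by_cases huC : u ∈ C
      · calc _ ≤ ((insert b C) \ {u}).ncard := by
              refine mvcSub_deleteVertex_le (fun x y h _ _ => (hC h).imp .inr .inr) ?_
              rw [hab]
              rintro x ⟨h | h | h, -⟩
              · exact .inr (hSC h)
              · exact .inr (h ▸ ha)
              · exact .inl h
          _ = (insert b C).ncard - 1 := Set.ncard_sdiff_singleton_of_mem (.inr huC)
          _ ≤ C.ncard := by
              have := Set.ncard_insert_le b C
              omega
      · calc _ ≤ (C \ {u}).ncard := by
              refine mvcSub_deleteVertex_le (fun x y h _ _ => hC h) ?_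
              rw [hab]
              rintro x ⟨h | h | h, -⟩
              · exact hSC h
              · exact h ▸ ha
              · exact h ▸ (hC hub).resolve_left huC
          _ ≤ C.ncard := Set.ncard_le_ncard Set.sdiff_subset
    rcases hC hvw with h | h
    · exact key v w huv huw rfl h
    · exact key w v huw huv (Set.pair_comm v w) h

/-! ### Connected covers -/

theorem HasConnectedCovers.exists_adj [Nontrivial V] (hG : HasConnectedCovers G) (x : V) :
    ∃ y, G.Adj x y := by
  obtain ⟨z, hz⟩ := exists_ne x
  obtain ⟨p, -⟩ := preconnected_induce_iff.1 (hG _ SimpleGraph.isVertexCover_univ)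
    x trivial z trivial
  cases p with
  | nil => exact absurd rfl hz
  | cons h p => exact ⟨_, h⟩

theorem reachable_of_forall_adj {W : Type*} {G' : SimpleGraph W} (f : V → W)
    (hf : ∀ a b, G.Adj a b → G'.Reachable (f a) (f b)) {a b : V} (h : G.Reachable a b) :
    G'.Reachable (f a) (f b) := by
  obtain ⟨p⟩ := h
  induction p with
  | nil => exact .rfl
  | cons h p ih => exact (hf _ _ h).trans ih

/-- If the two neighbours of `u` are adjacent, a walk through `u` can be rerouted: `u` is retracted
to one of its neighbours that belongs to the cover. -/
theorem HasConnectedCovers.deleteVertex (hG : HasConnectedCovers G) {u v w : V}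
    (hu : G.neighborSet u = {v, w}) (hvw : G.Adj v w) :
    HasConnectedCovers (deleteVertex G u).coe := by
  classical
  intro D hD
  have huv : G.Adj u v := (Set.ext_iff.1 hu v).2 (by simp)
  have huw : G.Adj u w := (Set.ext_iff.1 hu w).2 (by simp)
  have hcover : G.IsVertexCover (insert u (Subtype.val '' D)) := by
    intro x y hxy
    by_cases hx : x = u
    · exact .inl (.inl hx)
    · by_cases hy : y = u
      · exact .inr (.inl hy)
      · have h : (EVC.deleteVertex G u).coe.Adj ⟨x, mem_verts_deleteVertex.2 hx⟩
          ⟨y, mem_verts_deleteVertex.2 hy⟩ := deleteVertex_adj.2 ⟨hxy, hx, hy⟩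
        exact (hD h).imp (fun h => .inr ⟨_, h, rfl⟩) (fun h => .inr ⟨_, h, rfl⟩)
  -- `a` is the neighbour to which `u` is retracted
  obtain ⟨a, ha, hua, han⟩ : ∃ a : (EVC.deleteVertex G u).verts, a ∈ D ∧ G.Adj u a ∧
      ∀ x, G.Adj u x → x = a ∨ G.Adj a x := by
    have h : (EVC.deleteVertex G u).coe.Adj ⟨v, mem_verts_deleteVertex.2 huv.ne'⟩
      ⟨w, mem_verts_deleteVertex.2 huw.ne'⟩ := deleteVertex_adj.2 ⟨hvw, huv.ne', huw.ne'⟩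
    have hnb : ∀ x, G.Adj u x → x = v ∨ x = w := fun x hx => (Set.ext_iff.1 hu x).1 hx
    rcases hD h with h | h
    · refine ⟨_, h, huv, fun x hx => ?_⟩
      rcases hnb x hx with rfl | rfl
      · exact .inl rfl
      · exact .inr hvw
    · refine ⟨_, h, huw, fun x hx => ?_⟩
      rcases hnb x hx with rfl | rfl
      · exact .inr hvw.symm
      · exact .inl rfl
  have hmem : ∀ x : (insert u (Subtype.val '' D) : Set V), x.1 ≠ u →
      ∃ h : x.1 ∈ (EVC.deleteVertex G u).verts, (⟨x.1, h⟩ : (EVC.deleteVertex G u).verts) ∈ D := by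
    rintro ⟨x, rfl | ⟨y, hy, rfl⟩⟩ hx
    · exact absurd rfl hx
    · exact ⟨y.2, hy⟩
  let f : (insert u (Subtype.val '' D) : Set V) → D := fun x =>
    if h : x.1 = u then ⟨a, ha⟩ else ⟨⟨x.1, (hmem x h).1⟩, (hmem x h).2⟩
  have hfu : ∀ x, x.1 = u → f x = ⟨a, ha⟩ := fun x h => dif_pos h
  have hfn : ∀ x, x.1 ≠ u → (f x).1.1 = x.1 := fun x h => by
    simp only [f, dif_neg h]
  have hreach : ∀ p q : D, p.1.1 = q.1.1 ∨ G.Adj p.1.1 q.1.1 →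
      ((EVC.deleteVertex G u).coe.induce D).Reachable p q := by
    intro p q h
    rcases h with h | h
    · have : p = q := Subtype.ext (Subtype.ext h)
      exact this ▸ .rfl
    · refine SimpleGraph.Adj.reachable ?_
      exact deleteVertex_adj.2 ⟨h, mem_verts_deleteVertex.1 p.1.2, mem_verts_deleteVertex.1 q.1.2⟩
  have hf : ∀ x y, (G.induce (insert u (Subtype.val '' D))).Adj x y →
      ((EVC.deleteVertex G u).coe.induce D).Reachable (f x) (f y) := by
    intro x y hxy
    have hxy' : G.Adj x.1 y.1 := hxy
    by_cases hx : x.1 = u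
    · have hy : y.1 ≠ u := fun h => hxy'.ne (hx.trans h.symm)
      refine hreach _ _ ?_
      rw [hfn y hy, hfu x hx]
      rw [hx] at hxy'
      exact (han y.1 hxy').imp Eq.symm id
    · by_cases hy : y.1 = u
      · refine hreach _ _ ?_
        rw [hfn x hx, hfu y hy]
        rw [hy] at hxy'
        exact (han x.1 hxy'.symm).imp id SimpleGraph.Adj.symm
      · refine hreach _ _ ?_
        rw [hfn x hx, hfn y hy]
        exact .inr hxy'
  intro x y
  have hx := mem_verts_deleteVertex.1 x.1.2
  have hy := mem_verts_deleteVertex.1 y.1.2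
  have h := reachable_of_forall_adj f hf
    (hG _ hcover ⟨x.1.1, .inr ⟨x.1, x.2, rfl⟩⟩ ⟨y.1.1, .inr ⟨y.1, y.2, rfl⟩⟩)
  have e1 : f ⟨x.1.1, .inr ⟨x.1, x.2, rfl⟩⟩ = x := Subtype.ext (Subtype.ext (hfn _ hx))
  have e2 : f ⟨y.1.1, .inr ⟨y.1, y.2, rfl⟩⟩ = y := Subtype.ext (Subtype.ext (hfn _ hy))
  rwa [e1, e2] at h

/-- There is no cut vertex, as the complement of a single vertex is a cover. -/
theorem isBiconnected_of_hasConnectedCovers {H : G.Subgraph} (hne : H.verts.Nonempty)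
    (hH : HasConnectedCovers H.coe) : IsBiconnected H := by
  have : Nonempty H.verts := hne.to_subtype
  refine ⟨⟨⟨fun x y => ?_⟩⟩, ?_⟩
  · exact reachable_of_forall_adj (G' := H.coe) (fun a : (Set.univ : Set H.verts) => a.1)
      (fun a b h => SimpleGraph.Adj.reachable h)
      (hH _ SimpleGraph.isVertexCover_univ ⟨x, trivial⟩ ⟨y, trivial⟩)
  · intro x hx
    refine ⟨fun a b => ?_⟩
    have hcover : H.coe.IsVertexCover {z | z.1 ≠ x} := by
      intro p q hpq
      by_contra! h
      simp only [Set.mem_ofPred_eq, not_not] at h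
      exact hpq.ne (Subtype.ext (h.1.trans h.2.symm))
    exact reachable_of_forall_adj (G' := (H.deleteVerts {x}).coe)
      (fun z : {z : H.verts | z.1 ≠ x} =>
        (⟨z.1.1, z.1.2, z.2⟩ : (H.deleteVerts {x}).verts))
      (fun p q h => SimpleGraph.Adj.reachable <| show (H.deleteVerts {x}).Adj p.1 q.1 from
        SimpleGraph.Subgraph.deleteVerts_adj.2 ⟨p.1.2, p.2, q.1.2, q.2, h⟩)
      (hH _ hcover ⟨⟨a.1, a.2.1⟩, a.2.2⟩ ⟨⟨b.1, b.2.1⟩, b.2.2⟩)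

/-! ### The recurrences -/

theorem evcSub_deleteVertex_le_iff [Finite V] {u v w : V} (m : GuardModel)
    (hG : HasConnectedCovers G) (hu : G.neighborSet u = {v, w}) (hvw : G.Adj v w)
    (S : Set V) (k : ℕ) :
    evcSub m (deleteVertex G u) S ≤ k ↔
      ∀ x, x ≠ u → mvcSub (deleteVertex G u) (insert x S) ≤ k := by
  have huv : G.Adj u v := (Set.ext_iff.1 hu v).2 (by simp)
  have huw : G.Adj u w := (Set.ext_iff.1 hu w).2 (by simp)
  have hH := hG.deleteVertex hu hvw
  have : Nontrivial (deleteVertex G u).verts :=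
    ⟨⟨v, mem_verts_deleteVertex.2 huv.ne'⟩, ⟨w, mem_verts_deleteVertex.2 huw.ne'⟩,
      fun h => hvw.ne (congrArg Subtype.val h)⟩
  have hpre : ∀ x : (deleteVertex G u).verts,
      insert x (Subtype.val ⁻¹' S) = (Subtype.val ⁻¹' (insert x.1 S) : Set _) := by
    intro x
    ext z
    simp [Subtype.ext_iff]
  rw [evcSub, evc_le_iff m hH hH.exists_adj]
  constructor
  · intro h x hx
    have := h ⟨x, mem_verts_deleteVertex.2 hx⟩
    rwa [hpre] at this
  · intro h x
    rw [hpre]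
    exact h x.1 (mem_verts_deleteVertex.1 x.2)

/-- The four recurrences. All of them compare maxima of numbers `mvc`, by `evc_le_iff`. -/
theorem evc_recurrences [Finite V] {u v w : V} (m : GuardModel)
    (hG : HasConnectedCovers G) (hu : G.neighborSet u = {v, w}) (hvw : G.Adj v w) :
    evc m G ∅ = max (mvcSub (deleteVertex G u) ∅ + 1) (evcSub m (deleteVertex G u) {v, w}) ∧
    evc m G {u} = evcSub m (deleteVertex G u) ∅ + 1 ∧
    evc m G {u, v} = evcSub m (deleteVertex G u) {v} + 1 ∧
    evc m G {v} = max (mvc G {u, v}) (evc m G ∅) := by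
  have huv : G.Adj u v := (Set.ext_iff.1 hu v).2 (by simp)
  have : Nontrivial V := ⟨u, v, huv.ne⟩
  have hGle := evc_le_iff m hG hG.exists_adj
  have hHle := evcSub_deleteVertex_le_iff m hG hu hvw
  -- separate the maximum over all vertices of `G` into `u` and the vertices of `G - u`
  have split : ∀ (p : V → Prop), (∀ x, p x) ↔ p u ∧ ∀ x, x ≠ u → p x := fun p =>
    ⟨fun h => ⟨h u, fun x _ => h x⟩, fun h x => by
      by_cases hx : x = u
      · exact hx ▸ h.1
      · exact h.2 x hx⟩
  -- if `u` stays occupied, the term of `u` in the maximum is dominated by the term of `v`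
  have shift : ∀ S : Set V, u ∉ S →
      evc m G (insert u S) = evcSub m (deleteVertex G u) S + 1 := by
    intro S hS
    refine eq_of_forall_ge_iff fun k => ?_
    rw [hGle, split]
    have e1 : mvc G (insert u (insert u S)) = mvcSub (deleteVertex G u) S + 1 := by
      rw [Set.insert_idem, mvc_insert_eq]
    have e2 : ∀ x, mvc G (insert x (insert u S)) = mvcSub (deleteVertex G u) (insert x S) + 1 := by
      intro x
      rw [Set.insert_comm, mvc_insert_eq]
    simp only [e1, e2]
    cases k with
    | zero => simp
    | succ k =>
      simp only [Nat.add_le_add_iff_right]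
      rw [hHle]
      refine ⟨fun h => h.2, fun h => ⟨?_, h⟩⟩
      exact (mvcSub_deleteVertex_mono (Set.sdiff_subset.trans (Set.subset_insert _ _))).trans
        (h v huv.ne')
  refine ⟨?_, ?_, shift {v} (by simpa using huv.ne), ?_⟩
  · refine eq_of_forall_ge_iff fun k => ?_
    rw [hGle, split, max_le_iff, hHle, mvc_insert_eq]
    refine and_congr_right fun _ => forall₂_congr fun x hx => ?_
    rw [mvc_eq_mvcSub hu hvw (by simpa using hx.symm), Set.insert_union, Set.empty_union]
  · have := shift ∅ (by simp)
    rwa [insert_empty_eq] at this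
  · refine eq_of_forall_ge_iff fun k => ?_
    rw [max_le_iff, hGle, hGle, split, split (fun x => mvc G (insert x ∅) ≤ k)]
    have e : ∀ x, x ≠ u → mvc G (insert x {v}) = mvc G (insert x ∅) := by
      intro x hx
      rw [mvc_eq_mvcSub hu hvw (by simpa using ⟨hx.symm, huv.ne⟩),
        mvc_eq_mvcSub hu hvw (by simpa using hx.symm)]
      congr 1
      ext z
      simp only [Set.mem_union, Set.mem_insert_iff, Set.mem_singleton_iff,
        Set.mem_empty_iff_false]
      tauto
    have e' : mvc G (insert u ∅) ≤ mvc G {u, v} :=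
      mvc_mono (Set.insert_subset_insert (Set.empty_subset _))
    constructor
    · rintro ⟨h1, h2⟩
      exact ⟨h1, e'.trans h1, fun x hx => e x hx ▸ h2 x hx⟩
    · rintro ⟨h1, -, h2⟩
      exact ⟨h1, fun x hx => (e x hx).symm ▸ h2 x hx⟩

/-! ### Triangulations of a linearly ordered vertex set -/

/-- For `a < b` and `c < d`, exactly one of `c` and `d` is strictly between `a` and `b`, and
`a, b, c, d` are distinct: the chords `ab` and `cd` of a circle cross if the order is that of
the points along the circle. -/
def Interleave [LT V] (a b c d : V) : Prop :=
  (a < c ∧ c < b ∧ b < d) ∨ (c < a ∧ a < d ∧ d < b)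

/-- No two edges of `G` cross, and every chord that crosses no edge is an edge. For the vertices
of a convex polygon, `G` is then a triangulation of the polygon together with its sides. -/
structure IsTriangulation [LinearOrder V] (G : SimpleGraph V) : Prop where
  not_interleave : ∀ a b c d, a < b → c < d → G.Adj a b → G.Adj c d → ¬ Interleave a b c d
  adj_of_forall : ∀ a b, a < b → (∀ c d, c < d → G.Adj c d → ¬ Interleave a b c d) → G.Adj a b

namespace IsTriangulation

variable [LinearOrder V]

theorem adj_of_covBy (hG : IsTriangulation G) {a b : V} (hab : a ⋖ b) : G.Adj a b := by
  refine hG.adj_of_forall a b hab.lt fun c d _ _ h => ?_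
  rcases h with ⟨h1, h2, -⟩ | ⟨-, h1, h2⟩
  · exact hab.2 h1 h2
  · exact hab.2 h1 h2

theorem adj_of_isBot_isTop (hG : IsTriangulation G) {a b : V} (hab : a < b) (ha : IsBot a)
    (hb : IsTop b) : G.Adj a b := by
  refine hG.adj_of_forall a b hab fun c d _ _ h => ?_
  rcases h with ⟨-, -, h⟩ | ⟨h, -⟩
  · exact absurd h (hb d).not_gt
  · exact absurd h (ha c).not_gt

/-- On either side of an edge `ab` that contains further vertices, there is a triangle with
side `ab`. Its third vertex `c` is the last neighbour of `a` before `b`. -/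
theorem exists_triangle [Finite V] (hG : IsTriangulation G) {a b : V} (hadj : G.Adj a b)
    (h : ∃ x, a < x ∧ x < b) : ∃ c, a < c ∧ c < b ∧ G.Adj a c ∧ G.Adj c b := by
  have hne : {c | a < c ∧ c < b ∧ G.Adj a c}.Nonempty := by
    obtain ⟨c, hc⟩ := Set.Finite.exists_minimal (Set.toFinite {x | a < x ∧ x < b}) h
    refine ⟨c, hc.prop.1, hc.prop.2, hG.adj_of_covBy ⟨hc.prop.1, fun d had hdc => ?_⟩⟩
    exact hdc.not_ge (hc.le_of_le ⟨had, hdc.trans hc.prop.2⟩ hdc.le)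
  obtain ⟨c, hc⟩ := Set.Finite.exists_maximal (Set.toFinite _) hne
  obtain ⟨hac, hcb, hadjc⟩ := hc.prop
  refine ⟨c, hac, hcb, hadjc, hG.adj_of_forall c b hcb fun p q hpq hadj' hcross => ?_⟩
  rcases hcross with ⟨h1, h2, h3⟩ | ⟨h1, h2, h3⟩
  · exact hG.not_interleave a b p q (hac.trans hcb) hpq hadj hadj' (.inl ⟨hac.trans h1, h2, h3⟩)
  · rcases lt_trichotomy p a with h | rfl | h
    · exact hG.not_interleave a b p q (hac.trans hcb) hpq hadj hadj'
        (.inr ⟨h, hac.trans h2, h3⟩)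
    · exact absurd h2 (hc.le_of_ge ⟨hac.trans h2, h3, hadj'⟩ h2.le).not_gt
    · exact hG.not_interleave a c p q hac hpq hadjc hadj' (.inl ⟨h, h1, h2⟩)

/-- The part of a cover on one side of an edge is connected within the cover: a triangle on that
side has two vertices in the cover, through which the two smaller parts are joined. -/
theorem reachable_between [Finite V] (hG : IsTriangulation G) {C : Set V}
    (hC : G.IsVertexCover C) {a b : V} (hadj : G.Adj a b) (x y : C)
    (hx : a ≤ x ∧ x ≤ b) (hy : a ≤ y ∧ y ≤ b) : (G.induce C).Reachable x y := by
  by_cases h : ∃ x, a < x ∧ x < b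
  · obtain ⟨c, hac, hcb, hadj1, hadj2⟩ := hG.exists_triangle hadj h
    have left := reachable_between hG hC hadj1
    have right := reachable_between hG hC hadj2
    have cross : ∀ x y : C, a ≤ x ∧ x ≤ c → c ≤ y ∧ y ≤ b → (G.induce C).Reachable x y := by
      intro x y hx hy
      by_cases hcC : c ∈ C
      · exact (left x ⟨c, hcC⟩ hx ⟨hac.le, le_rfl⟩).trans
          (right ⟨c, hcC⟩ y ⟨le_rfl, hcb.le⟩ hy)
      · have haC : a ∈ C := (hC hadj1).resolve_right hcC
        have hbC : b ∈ C := (hC hadj2).resolve_left hcC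
        have e : (G.induce C).Reachable ⟨a, haC⟩ ⟨b, hbC⟩ := SimpleGraph.Adj.reachable hadj
        exact (left x ⟨a, haC⟩ hx ⟨le_rfl, hac.le⟩).trans
          (e.trans (right ⟨b, hbC⟩ y ⟨hcb.le, le_rfl⟩ hy))
    rcases le_total (x : V) c with hxc | hxc <;> rcases le_total (y : V) c with hyc | hyc
    · exact left x y ⟨hx.1, hxc⟩ ⟨hy.1, hyc⟩
    · exact cross x y ⟨hx.1, hxc⟩ ⟨hyc, hy.2⟩
    · exact (cross y x ⟨hy.1, hyc⟩ ⟨hxc, hx.2⟩).symm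
    · exact right x y ⟨hxc, hx.2⟩ ⟨hyc, hy.2⟩
  · push Not at h
    have key : ∀ z : C, a ≤ z ∧ z ≤ b → (z : V) = a ∨ (z : V) = b := fun z hz => by
      rcases hz.1.eq_or_lt with h1 | h1
      · exact .inl h1.symm
      · exact .inr (le_antisymm hz.2 (h z h1))
    by_cases hxy : x = y
    · exact hxy ▸ .rfl
    · refine SimpleGraph.Adj.reachable (?_ : G.Adj x y)
      have hne : (x : V) ≠ y := fun h => hxy (Subtype.ext h)
      rcases key x hx with h1 | h1 <;> rcases key y hy with h2 | h2
      · exact absurd (h1.trans h2.symm) hne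
      · rw [h1, h2]; exact hadj
      · rw [h1, h2]; exact hadj.symm
      · exact absurd (h1.trans h2.symm) hne
termination_by (Set.Icc a b).ncard
decreasing_by
  · refine Set.ncard_lt_ncard (Set.ssubset_iff_subset_ne.2
      ⟨Set.Icc_subset_Icc_right hcb.le, fun h => ?_⟩)
    exact (h.symm ▸ Set.right_mem_Icc.2 (hac.trans hcb).le : b ∈ Set.Icc a c).2.not_gt hcb
  · refine Set.ncard_lt_ncard (Set.ssubset_iff_subset_ne.2
      ⟨Set.Icc_subset_Icc_left hac.le, fun h => ?_⟩)
    exact (h.symm ▸ Set.left_mem_Icc.2 (hac.trans hcb).le : a ∈ Set.Icc c b).1.not_gt hac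

theorem hasConnectedCovers [Finite V] (hG : IsTriangulation G) : HasConnectedCovers G := by
  intro C hC x y
  obtain ⟨a, ha⟩ : ∃ a : V, IsBot a := by
    have : Nonempty V := ⟨x⟩
    obtain ⟨a, ha⟩ := Finite.exists_min (id : V → V)
    exact ⟨a, ha⟩
  obtain ⟨b, hb⟩ : ∃ b : V, IsTop b := by
    have : Nonempty V := ⟨x⟩
    obtain ⟨b, hb⟩ := Finite.exists_max (id : V → V)
    exact ⟨b, hb⟩
  rcases (ha b).eq_or_lt with hab | hab
  · have : x = y := Subtype.ext (le_antisymm (((hb x).trans hab.ge).trans (ha y))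
      (((hb y).trans hab.ge).trans (ha x)))
    exact this ▸ .rfl
  · exact hG.reachable_between hC (hG.adj_of_isBot_isTop hab ha hb) x y
      ⟨ha x, hb x⟩ ⟨ha y, hb y⟩

/-- The neighbours of a vertex `u` of degree two are next to `u` along the circle; here `u` is
last in the order, so that they are the first and the last of the remaining vertices. They are
adjacent, as only edges at `u` could cross the chord between them. -/
theorem adj_of_neighborSet [Finite V] (hG : IsTriangulation G) {u v w : V} (hvw : v ≠ w)
    (hu : G.neighborSet u = {v, w}) (htop : IsTop u) :
    G.Adj v w ∧ ∀ x, x ≠ u → min v w ≤ x ∧ x ≤ max v w := by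
  have hv : G.Adj u v := (Set.ext_iff.1 hu v).2 (by simp)
  have hw : G.Adj u w := (Set.ext_iff.1 hu w).2 (by simp)
  have hnb : ∀ x, G.Adj u x → x = v ∨ x = w := fun x hx => (Set.ext_iff.1 hu x).1 hx
  wlog hlt : v < w generalizing v w with H
  · have := H hvw.symm (by rw [hu, Set.pair_comm]) hw hv (fun x hx => (hnb x hx).symm)
      (lt_of_le_of_ne (not_lt.1 hlt) hvw.symm)
    rw [min_comm, max_comm]
    exact ⟨this.1.symm, this.2⟩
  rw [min_eq_left hlt.le, max_eq_right hlt.le]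
  have hltu : ∀ x, x ≠ u → x < u := fun x hx => lt_of_le_of_ne (htop x) hx
  obtain ⟨a, ha⟩ : ∃ a : V, IsBot a := by
    have : Nonempty V := ⟨u⟩
    obtain ⟨a, ha⟩ := Finite.exists_min (id : V → V)
    exact ⟨a, ha⟩
  have hau : a < u := (ha v).trans_lt (hltu v hv.ne')
  obtain ⟨b, hb⟩ := Set.Finite.exists_maximal (Set.toFinite {x | x < u}) ⟨a, hau⟩
  have hbmax : ∀ x, x ≠ u → x ≤ b := fun x hx => by
    rcases le_total x b with h | h
    · exact h
    · exact hb.le_of_ge (hltu x hx) h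
  have hub : G.Adj u b := (hG.adj_of_covBy ⟨hb.prop, fun c hbc hcu =>
    hbc.not_ge (hbmax c hcu.ne)⟩).symm
  have hua : G.Adj u a := (hG.adj_of_isBot_isTop hau ha htop).symm
  obtain rfl : a = v := by
    refine (hnb a hua).resolve_right fun h => ?_
    exact absurd hlt (h ▸ ha v).not_gt
  obtain rfl : b = w := by
    refine (hnb b hub).resolve_left fun h => ?_
    exact absurd hlt (h ▸ hbmax w hw.ne').not_gt
  refine ⟨hG.adj_of_forall a b hlt fun c d hcd hadj h => ?_, fun x hx => ⟨ha x, hbmax x hx⟩⟩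
  rcases h with ⟨h1, h2, h3⟩ | ⟨h, -⟩
  · obtain rfl : d = u := by
      by_contra hd
      exact h3.not_ge (hbmax d hd)
    rcases hnb c hadj.symm with h | h
    · exact h1.ne' h
    · exact h2.ne h
  · exact h.not_ge (ha c)

end IsTriangulation

/-! ### Chords of the unit circle -/

/-- Twice the signed area of the triangle `abz`. It is positive if `z` is to the left of the
line from `a` to `b`. -/
def side (a b z : ℂ) : ℝ :=
  (b.re - a.re) * (z.im - a.im) - (b.im - a.im) * (z.re - a.re)

theorem side_combo (a b c d : ℂ) {s t : ℝ} (h : s + t = 1) :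
    side a b (s • c + t • d) = s * side a b c + t * side a b d := by
  obtain rfl : s = 1 - t := by linarith
  simp only [side, Complex.add_re, Complex.add_im, Complex.real_smul, Complex.re_ofReal_mul,
    Complex.im_ofReal_mul]
  ring

theorem side_left (a b : ℂ) : side a b a = 0 := by simp [side]

theorem side_right (a b : ℂ) : side a b b = 0 := by simp only [side]; ring

theorem side_mul (r a b z : ℂ) : side (r * a) (r * b) (r * z) = Complex.normSq r * side a b z := by
  simp only [side, Complex.mul_re, Complex.mul_im, Complex.normSq_apply]
  ring

theorem side_exp (α β ζ : ℝ) :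
    side (Complex.exp (α * Complex.I)) (Complex.exp (β * Complex.I)) (Complex.exp (ζ * Complex.I)) =
      4 * Real.sin ((β - α) / 2) * Real.sin ((ζ - β) / 2) * Real.sin ((ζ - α) / 2) := by
  simp only [side, Complex.exp_ofReal_mul_I_re, Complex.exp_ofReal_mul_I_im]
  have hsin : ∀ x, Real.sin x = 2 * Real.sin (x / 2) * Real.cos (x / 2) := fun x => by
    rw [← Real.sin_two_mul]; congr 1; ring
  have hcos : ∀ x, Real.cos x = Real.cos (x / 2) ^ 2 - Real.sin (x / 2) ^ 2 := fun x => by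
    rw [← Real.cos_two_mul']; congr 1; ring
  rw [hsin α, hsin β, hsin ζ, hcos α, hcos β, hcos ζ, sub_div, sub_div, sub_div,
    Real.sin_sub, Real.sin_sub, Real.sin_sub]
  have h1 := Real.sin_sq_add_cos_sq (α / 2)
  have h2 := Real.sin_sq_add_cos_sq (β / 2)
  have h3 := Real.sin_sq_add_cos_sq (ζ / 2)
  generalize Real.sin (α / 2) = s₁ at *
  generalize Real.cos (α / 2) = c₁ at *
  generalize Real.sin (β / 2) = s₂ at *
  generalize Real.cos (β / 2) = c₂ at *
  generalize Real.sin (ζ / 2) = s₃ at *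
  generalize Real.cos (ζ / 2) = c₃ at *
  -- both sides agree after homogenization, each of the three summands of the area being
  -- multiplied by the missing `sin ^ 2 + cos ^ 2`
  linear_combination
    (-((c₁ ^ 2 - s₁ ^ 2) * (2 * s₂ * c₂) - 2 * s₁ * c₁ * (c₂ ^ 2 - s₂ ^ 2))) * h3
    - ((c₂ ^ 2 - s₂ ^ 2) * (2 * s₃ * c₃) - 2 * s₂ * c₂ * (c₃ ^ 2 - s₃ ^ 2)) * h1
    - ((c₃ ^ 2 - s₃ ^ 2) * (2 * s₁ * c₁) - 2 * s₃ * c₃ * (c₁ ^ 2 - s₁ ^ 2)) * h2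

theorem not_disjoint_of_side {a b c d : ℂ} (h1 : side a b c < 0) (h2 : 0 < side a b d)
    (h3 : 0 < side c d a) (h4 : side c d b < 0) :
    ¬ Disjoint (openSegment ℝ a b) (openSegment ℝ c d) := by
  have hD : side a b d - side a b c = side c d a - side c d b := by
    simp only [side]; ring
  set D := side a b d - side a b c with hDdef
  have hpos : 0 < D := by linarith
  have e : (side a b d / D) • c + (-side a b c / D) • d =
      (-side c d b / D) • a + (side c d a / D) • b := by
    have key : side a b d • c + (-side a b c) • d = (-side c d b) • a + side c d a • b := by
      apply Complex.ext <;>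
      · simp only [side, Complex.add_re, Complex.add_im, Complex.real_smul,
          Complex.re_ofReal_mul, Complex.im_ofReal_mul]
        ring
    have := congrArg (fun z => D⁻¹ • z) key
    simpa only [smul_add, smul_smul, inv_mul_eq_div] using this
  rw [Set.not_disjoint_iff]
  refine ⟨_, ⟨-side c d b / D, side c d a / D, div_pos (neg_pos.2 h4) hpos, div_pos h3 hpos, ?_,
    rfl⟩, ⟨side a b d / D, -side a b c / D, div_pos h2 hpos, div_pos (neg_pos.2 h1) hpos, ?_, e⟩⟩
  · rw [← add_div, div_eq_one_iff_eq hpos.ne']; linarith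
  · rw [← add_div, div_eq_one_iff_eq hpos.ne']; linarith

theorem disjoint_of_side {a b c d : ℂ}
    (h : (0 ≤ side a b c ∧ 0 ≤ side a b d ∧ (side a b c ≠ 0 ∨ side a b d ≠ 0)) ∨
      (side a b c ≤ 0 ∧ side a b d ≤ 0 ∧ (side a b c ≠ 0 ∨ side a b d ≠ 0))) :
    Disjoint (openSegment ℝ a b) (openSegment ℝ c d) := by
  rw [Set.disjoint_left]
  rintro z ⟨s, t, -, -, hst, rfl⟩ ⟨s', t', hs', ht', hst', hz⟩
  have e : s' * side a b c + t' * side a b d = 0 := by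
    rw [← side_combo a b c d hst', hz, side_combo a b a b hst, side_left, side_right]
    simp
  rcases h with ⟨h1, h2, h3⟩ | ⟨h1, h2, h3⟩
  · have k1 := mul_nonneg hs'.le h1
    have k2 := mul_nonneg ht'.le h2
    rcases h3 with h3 | h3
    · have := mul_pos hs' (lt_of_le_of_ne h1 h3.symm)
      linarith
    · have := mul_pos ht' (lt_of_le_of_ne h2 h3.symm)
      linarith
  · have k1 := mul_nonneg hs'.le (neg_nonneg.2 h1)
    have k2 := mul_nonneg ht'.le (neg_nonneg.2 h2)
    rcases h3 with h3 | h3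
    · have := mul_pos hs' (neg_pos.2 (lt_of_le_of_ne h1 h3))
      linarith
    · have := mul_pos ht' (neg_pos.2 (lt_of_le_of_ne h2 h3))
      linarith

/-- The points `pos x` are in convex position, and the linear order of the vertices is the
counterclockwise order in which they appear, from some starting point. -/
structure IsCircularOrder [LinearOrder V] (pos : V → ℂ) : Prop where
  side_neg : ∀ a b z, a < z → z < b → side (pos a) (pos b) (pos z) < 0
  side_pos : ∀ a b z, a < b → z < a ∨ b < z → 0 < side (pos a) (pos b) (pos z)

/-- The points of the unit circle are ordered by their angles, which are measured here from the
prescribed last point `u`. -/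
theorem OuterplanarEmbedding.exists_isCircularOrder (E : OuterplanarEmbedding G) (u : V) :
    ∃ _ : LinearOrder V, IsTop u ∧ IsCircularOrder E.pos := by
  have hu0 : E.pos u ≠ 0 := fun h => by simpa [h] using E.norm_pos u
  let θ : V → ℝ := fun x => Complex.arg (-(E.pos x) / E.pos u)
  have hθ : ∀ x, E.pos x = -E.pos u * Complex.exp (θ x * Complex.I) := by
    intro x
    have := Complex.norm_mul_exp_arg_mul_I (-(E.pos x) / E.pos u)
    rw [norm_div, norm_neg, E.norm_pos, E.norm_pos, div_one, Complex.ofReal_one, one_mul] at this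
    rw [this]
    field_simp
  have hinj : Function.Injective θ := fun x y h => E.pos_injective (by rw [hθ x, hθ y, h])
  have hupper : ∀ x, θ x ≤ Real.pi := fun x => Complex.arg_le_pi _
  have hlower : ∀ x, -Real.pi < θ x := fun x => Complex.neg_pi_lt_arg _
  have htop : θ u = Real.pi := by
    simp only [θ]
    rw [neg_div, div_self hu0, Complex.arg_neg_one]
  have hr : 0 < Complex.normSq (-E.pos u) := Complex.normSq_pos.2 (neg_ne_zero.2 hu0)
  have hside : ∀ a b z, side (E.pos a) (E.pos b) (E.pos z) = Complex.normSq (-E.pos u) *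
      (4 * Real.sin ((θ b - θ a) / 2) * Real.sin ((θ z - θ b) / 2) *
        Real.sin ((θ z - θ a) / 2)) := by
    intro a b z
    rw [hθ a, hθ b, hθ z, side_mul, side_exp]
  have hsin : ∀ a b, θ a < θ b → 0 < Real.sin ((θ b - θ a) / 2) := fun a b h =>
    Real.sin_pos_of_pos_of_lt_pi (by linarith) (by linarith [hupper b, hlower a])
  have hsin' : ∀ a b, θ b < θ a → Real.sin ((θ b - θ a) / 2) < 0 := fun a b h =>
    Real.sin_neg_of_neg_of_neg_pi_lt (by linarith) (by linarith [hupper a, hlower b])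
  let order : LinearOrder V := LinearOrder.lift' θ hinj
  refine ⟨order, fun x => ?_, ⟨fun a b z h1 h2 => ?_, fun a b z hab h => ?_⟩⟩
  · exact (hupper x).trans htop.ge
  · have h1' : θ a < θ z := h1
    have h2' : θ z < θ b := h2
    rw [hside]
    refine mul_neg_of_pos_of_neg hr (mul_neg_of_neg_of_pos (mul_neg_of_pos_of_neg ?_
      (hsin' b z h2')) (hsin a z h1'))
    exact mul_pos four_pos (hsin a b (h1'.trans h2'))
  · have hab' : θ a < θ b := hab
    rw [hside]
    refine mul_pos hr ?_
    rcases h with h | h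
    · have h' : θ z < θ a := h
      exact mul_pos_of_neg_of_neg (mul_neg_of_pos_of_neg (mul_pos four_pos (hsin a b hab'))
        (hsin' b z (h'.trans hab'))) (hsin' a z h')
    · have h' : θ b < θ z := h
      exact mul_pos (mul_pos (mul_pos four_pos (hsin a b hab')) (hsin b z h'))
        (hsin a z (hab'.trans h'))

namespace IsCircularOrder

variable [LinearOrder V] {pos : V → ℂ}

theorem not_disjoint (hp : IsCircularOrder pos) {a b c d : V} (h : Interleave a b c d) :
    ¬ Disjoint (openSegment ℝ (pos a) (pos b)) (openSegment ℝ (pos c) (pos d)) := by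
  have key : ∀ a b c d : V, a < c → c < b → b < d →
      ¬ Disjoint (openSegment ℝ (pos a) (pos b)) (openSegment ℝ (pos c) (pos d)) :=
    fun a b c d h1 h2 h3 => not_disjoint_of_side (hp.side_neg _ _ _ h1 h2)
      (hp.side_pos _ _ _ (h1.trans h2) (.inr h3)) (hp.side_pos _ _ _ (h2.trans h3) (.inl h1))
      (hp.side_neg _ _ _ h2 h3)
  rcases h with ⟨h1, h2, h3⟩ | ⟨h1, h2, h3⟩
  · exact key a b c d h1 h2 h3
  · rw [disjoint_comm]
    exact key c d a b h1 h2 h3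

theorem disjoint (hp : IsCircularOrder pos) {a b c d : V} (hab : a < b) (hcd : c < d)
    (hne : s(a, b) ≠ s(c, d)) (h : ¬ Interleave a b c d) :
    Disjoint (openSegment ℝ (pos a) (pos b)) (openSegment ℝ (pos c) (pos d)) := by
  have inside : ∀ z, a < z → z < b → side (pos a) (pos b) (pos z) < 0 := hp.side_neg a b
  have outside : ∀ z, z < a ∨ b < z → 0 < side (pos a) (pos b) (pos z) :=
    fun z => hp.side_pos a b z hab
  have ha : side (pos a) (pos b) (pos a) = 0 := side_left _ _
  have hb : side (pos a) (pos b) (pos b) = 0 := side_right _ _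
  have cases : ∀ z, 0 < side (pos a) (pos b) (pos z) ∧ (z < a ∨ b < z) ∨
      side (pos a) (pos b) (pos z) = 0 ∧ (z = a ∨ z = b) ∨
      side (pos a) (pos b) (pos z) < 0 ∧ a < z ∧ z < b := by
    intro z
    rcases lt_trichotomy z a with h | rfl | h
    · exact .inl ⟨outside z (.inl h), .inl h⟩
    · exact .inr (.inl ⟨ha, .inl rfl⟩)
    · rcases lt_trichotomy z b with h' | rfl | h'
      · exact .inr (.inr ⟨inside z h h', h, h'⟩)
      · exact .inr (.inl ⟨hb, .inr rfl⟩)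
      · exact .inl ⟨outside z (.inr h'), .inr h'⟩
  apply disjoint_of_side
  rcases cases c with ⟨hc, hc'⟩ | ⟨hc, hc'⟩ | ⟨hc, hc'⟩ <;>
    rcases cases d with ⟨hd, hd'⟩ | ⟨hd, hd'⟩ | ⟨hd, hd'⟩
  · exact .inl ⟨hc.le, hd.le, .inl hc.ne'⟩
  · exact .inl ⟨hc.le, hd.ge, .inl hc.ne'⟩
  · refine absurd (.inr ⟨?_, hd'⟩) h
    exact hc'.resolve_right fun h => (h.trans hcd).not_gt hd'.2
  · exact .inl ⟨hc.ge, hd.le, .inr hd.ne'⟩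
  · exfalso
    rcases hc' with rfl | rfl <;> rcases hd' with rfl | rfl
    · exact hcd.false
    · exact hne rfl
    · exact hne Sym2.eq_swap
    · exact hcd.false
  · exact .inr ⟨hc.le, hd.le, .inr hd.ne⟩
  · refine absurd (.inl ⟨hc'.1, hc'.2, ?_⟩) h
    exact hd'.resolve_left fun h => (h.trans hc'.1).not_gt hcd
  · exact .inr ⟨hc.le, hd.le, .inl hc.ne⟩
  · exact .inr ⟨hc.le, hd.le, .inl hc.ne⟩

/-- A chord that crosses no edge can be added to a maximal outerplanar graph, hence is an edge. -/
theorem isTriangulation {E : OuterplanarEmbedding G} (hp : IsCircularOrder E.pos)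
    (hG : IsMaximalOuterplanar G) : IsTriangulation G where
  not_interleave a b c d hab hcd hadj hadj' h := by
    refine hp.not_disjoint h (E.noncrossing a b c d hadj hadj' fun heq => ?_)
    rcases Sym2.eq_iff.1 heq with ⟨rfl, rfl⟩ | ⟨rfl, rfl⟩
    · rcases h with ⟨h, -⟩ | ⟨h, -⟩ <;> exact h.false
    · exact hab.not_gt hcd
  adj_of_forall a b hab h := by
    have hnew : ∀ c d, G.Adj c d → s(a, b) ≠ s(c, d) →
        Disjoint (openSegment ℝ (E.pos a) (E.pos b)) (openSegment ℝ (E.pos c) (E.pos d)) := by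
      intro c d hadj hne
      rcases hadj.ne.lt_or_gt with hcd | hcd
      · exact hp.disjoint hab hcd hne (h c d hcd hadj)
      · rw [openSegment_symm ℝ (E.pos c)]
        exact hp.disjoint hab hcd (Sym2.eq_swap (a := c) ▸ hne) (h d c hcd hadj.symm)
    have hseg : ∀ c d, s(c, d) = s(a, b) →
        openSegment ℝ (E.pos c) (E.pos d) = openSegment ℝ (E.pos a) (E.pos b) := by
      intro c d heq
      rcases Sym2.eq_iff.1 heq with ⟨rfl, rfl⟩ | ⟨rfl, rfl⟩
      · rfl
      · exact openSegment_symm ℝ _ _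
    have hadj : ∀ c d, (G ⊔ SimpleGraph.edge a b).Adj c d → G.Adj c d ∨ s(c, d) = s(a, b) := by
      intro c d hcd
      rw [SimpleGraph.sup_adj, SimpleGraph.edge_adj] at hcd
      rcases hcd with h | ⟨⟨rfl, rfl⟩ | ⟨rfl, rfl⟩, -⟩
      · exact .inl h
      · exact .inr rfl
      · exact .inr Sym2.eq_swap
    have hout : IsOuterplanar (G ⊔ SimpleGraph.edge a b) := by
      refine ⟨⟨E.pos, E.pos_injective, E.norm_pos, fun c d e f hcd hef hne => ?_⟩⟩
      rcases hadj c d hcd with h1 | h1 <;> rcases hadj e f hef with h2 | h2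
      · exact E.noncrossing c d e f h1 h2 hne
      · rw [hseg e f h2, disjoint_comm]
        exact hnew c d h1 (h2 ▸ hne.symm)
      · rw [hseg c d h1]
        exact hnew e f h2 (h1 ▸ hne)
      · exact absurd (h1.trans h2.symm) hne
    refine hG.le_of_ge hout le_sup_left ?_
    rw [SimpleGraph.sup_adj, SimpleGraph.edge_adj]
    exact .inr ⟨.inl ⟨rfl, rfl⟩, hab.ne⟩

end IsCircularOrder

/-! ### The exterior face of `G - u` -/

/-- An edge is on the boundary of the exterior face if the drawing is on one side of its line: the
open half-plane on the other side is an unbounded connected set that avoids the drawing. -/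
theorem OuterplanarEmbedding.isOuterEdge_of_side (E : OuterplanarEmbedding G) {K : G.Subgraph}
    {v w : V} (hvw : K.Adj v w) (hK : ∀ x ∈ K.verts, side (E.pos v) (E.pos w) (E.pos x) ≤ 0)
    {p : ℂ} (hp : 0 < side (E.pos v) (E.pos w) p) : E.IsOuterEdge K v w := by
  set L := side (E.pos v) (E.pos w) with hL
  let P : Set ℂ := {z | 0 < L z}
  let d : ℂ := p - E.pos v
  have hshift : ∀ z (t : ℝ), L (z + t • d) = L z + t * L p := by
    intro z t
    simp only [hL, d, side, Complex.add_re, Complex.add_im, Complex.real_smul,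
      Complex.re_ofReal_mul, Complex.im_ofReal_mul, Complex.sub_re, Complex.sub_im]
    ring
  have hd : d ≠ 0 := fun h => by
    rw [sub_eq_zero.1 h, hL, side_left] at hp
    exact hp.false
  have hconv : Convex ℝ P := by
    intro x hx y hy s t hs ht hst
    change 0 < L (s • x + t • y)
    rw [hL, side_combo _ _ _ _ hst]
    rcases hs.eq_or_lt with rfl | hs
    · rw [zero_add] at hst
      rw [hst, zero_mul, zero_add, one_mul]
      exact hy
    · exact add_pos_of_pos_of_nonneg (mul_pos hs hx) (mul_nonneg ht (le_of_lt hy))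
  have hseg : ∀ x ∈ K.verts, ∀ y ∈ K.verts, ∀ z ∈ segment ℝ (E.pos x) (E.pos y), L z ≤ 0 := by
    rintro x hx y hy _ ⟨s, t, hs, ht, hst, rfl⟩
    rw [hL, side_combo _ _ _ _ hst]
    exact add_nonpos (mul_nonpos_of_nonneg_of_nonpos hs (hK x hx))
      (mul_nonpos_of_nonneg_of_nonpos ht (hK y hy))
  have hPdraw : P ⊆ (E.drawing K)ᶜ := by
    rintro z hz (⟨x, hx, rfl⟩ | ⟨x, y, hxy, hz'⟩)
    · exact (hK x hx).not_gt hz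
    · exact (hseg x hxy.fst_mem y hxy.snd_mem z hz').not_gt hz
  have hPunb : ¬ Bornology.IsBounded P := by
    intro hb
    obtain ⟨R, hR⟩ := hb.exists_norm_le
    have hdpos : 0 < ‖d‖ := norm_pos_iff.2 hd
    have ht : 0 < (|R| + 2) / ‖d‖ := div_pos (by positivity) hdpos
    have hmem : E.pos v + ((|R| + 2) / ‖d‖) • d ∈ P := by
      change 0 < L _
      rw [hshift, hL, side_left, zero_add]
      exact mul_pos ht hp
    have h1 := hR _ hmem
    have h2 : ‖((|R| + 2) / ‖d‖) • d‖ = |R| + 2 := by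
      rw [norm_smul, Real.norm_of_nonneg ht.le, div_mul_cancel₀ _ hdpos.ne']
    have h3 := norm_sub_le (E.pos v + ((|R| + 2) / ‖d‖) • d) (E.pos v)
    rw [add_sub_cancel_left, h2, E.norm_pos] at h3
    linarith [le_abs_self R]
  have hPouter : P ⊆ E.outerFace K := fun z hz =>
    ⟨hPdraw hz, fun hb => hPunb (hb.subset
      (hconv.isPreconnected.subset_connectedComponentIn hz hPdraw))⟩
  refine ⟨hvw, fun z hz => ⟨?_, fun hint => ?_⟩⟩
  · have hz0 : L z = 0 := by
      obtain ⟨s, t, -, -, hst, rfl⟩ := hz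
      rw [hL, side_combo _ _ _ _ hst, side_left, side_right, mul_zero, mul_zero, add_zero]
    have hcont : Continuous fun t : ℝ => z + t • d := by fun_prop
    refine closure_mono hPouter (mem_closure_of_tendsto (b := nhdsWithin (0 : ℝ) (Set.Ioi 0))
      ((hcont.tendsto' 0 z (by simp)).mono_left nhdsWithin_le_nhds) ?_)
    filter_upwards [self_mem_nhdsWithin] with t ht
    change 0 < L _
    rw [hshift, hz0, zero_add]
    exact mul_pos ht hp
  · exact (interior_subset hint).1 (.inr ⟨v, w, hvw, hz⟩)

theorem OuterplanarEmbedding.IsOuterEdge.symm {E : OuterplanarEmbedding G} {K : G.Subgraph}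
    {v w : V} (h : E.IsOuterEdge K v w) : E.IsOuterEdge K w v :=
  ⟨h.1.symm, segment_symm ℝ (E.pos v) (E.pos w) ▸ h.2⟩

/-- In a maximal outerplanar graph, the neighbours of a vertex of degree two are adjacent, all
covers are connected, and the segment opposite to `u` is `G - u`. -/
theorem OuterplanarEmbedding.structure_of_degree_two [Finite V] (E : OuterplanarEmbedding G)
    (hG : IsMaximalOuterplanar G) {u v w : V} (hvw : v ≠ w) (hu : G.neighborSet u = {v, w}) :
    HasConnectedCovers G ∧ G.Adj v w ∧
      ∀ H : G.Subgraph, IsSegment E u v w H → H = deleteVertex G u := by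
  obtain ⟨_, htop, hp⟩ := E.exists_isCircularOrder u
  have hT := hp.isTriangulation hG
  obtain ⟨hadj, hbetween⟩ := hT.adj_of_neighborSet hvw hu htop
  have hcov := hT.hasConnectedCovers
  have huv : G.Adj u v := (Set.ext_iff.1 hu v).2 (by simp)
  have huw : G.Adj u w := (Set.ext_iff.1 hu w).2 (by simp)
  have houter : ∀ a b, a < b → G.Adj a b → a ≠ u → b ≠ u → (∀ x, x ≠ u → a ≤ x ∧ x ≤ b) →
      E.IsOuterEdge (deleteVertex G u) a b := by
    intro a b hab hadj ha hb hx
    refine E.isOuterEdge_of_side (deleteVertex_adj.2 ⟨hadj, ha, hb⟩) (fun x hxK => ?_)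
      (hp.side_pos a b u hab (.inr (lt_of_le_of_ne (htop b) hb)))
    obtain ⟨h1, h2⟩ := hx x (mem_verts_deleteVertex.1 hxK)
    rcases h1.eq_or_lt with rfl | h1
    · exact (side_left _ _).le
    · rcases h2.eq_or_lt with rfl | h2
      · exact (side_right _ _).le
      · exact (hp.side_neg a b x h1 h2).le
  have hedge : E.IsOuterEdge (deleteVertex G u) v w := by
    rcases hvw.lt_or_gt with h | h
    · rw [min_eq_left h.le, max_eq_right h.le] at hbetween
      exact houter v w h hadj huv.ne' huw.ne' hbetween
    · rw [min_eq_right h.le, max_eq_left h.le] at hbetween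
      exact (houter w v h hadj.symm huw.ne' huv.ne' hbetween).symm
  refine ⟨hcov, hadj, fun H hH =>
    hH.eq_of_le ⟨?_, hedge, fun h => mem_verts_deleteVertex.1 h rfl⟩ ?_⟩
  · exact isBiconnected_of_hasConnectedCovers ⟨v, mem_verts_deleteVertex.2 huv.ne'⟩
      (hcov.deleteVertex hu hadj)
  · have hne : ∀ x ∈ H.verts, x ≠ u := fun x hx h => hH.prop.2.2 (h ▸ hx)
    exact ⟨fun x hx => mem_verts_deleteVertex.2 (hne x hx), fun x y hxy =>
      deleteVertex_adj.2 ⟨hxy.adj_sub, hne x hxy.fst_mem, hne y hxy.snd_mem⟩⟩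

/-! ### Programs -/

/-- The program that computes `max (r₀ + 1) r₄`; register `6` holds zero. -/
def maxProgram : List Instr :=
  [.const 5 1, .add 0 0 5, .jumpLE 4 0 4, .add 0 4 6]

theorem maxProgram_computes (a b c d e : ℕ) :
    ComputesWithin maxProgram 6 [a, b, c, d, e] [max (a + 1) e] := by
  by_cases h : e ≤ a + 1
  · refine ⟨3, by norm_num, _, rfl, ?_, ?_⟩ <;>
      simp [machineStep, maxProgram, Instr.exec, h]
  · refine ⟨4, by norm_num, _, rfl, ?_, ?_⟩ <;>
      simp [machineStep, maxProgram, Instr.exec, h]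
    omega

/-- The program that computes `r₅ + 1`, `max r₄ r₀` and `r₆ + 1`; register `10` holds zero. -/
def remainingProgram : List Instr :=
  [.const 9 1, .add 2 6 9, .add 1 0 10, .add 0 5 9, .jumpLE 4 1 6, .add 1 4 10]

theorem remainingProgram_computes (a b c d e f g h i : ℕ) :
    ComputesWithin remainingProgram 6 [a, b, c, d, e, f, g, h, i] [f + 1, max e a, g + 1] := by
  by_cases hle : e ≤ a
  · refine ⟨5, by norm_num, _, rfl, ?_, ?_⟩ <;>
      simp [machineStep, remainingProgram, Instr.exec, hle, List.range_succ]
  · refine ⟨6, by norm_num, _, rfl, ?_, ?_⟩ <;>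
      simp [machineStep, remainingProgram, Instr.exec, hle, List.range_succ]
    omega

end EVC

theorem mainTheorem2 :
    ∃ (P₁ P₂ : List Instr) (T : ℕ),
      ∀ (V : Type*) [Finite V] (G : SimpleGraph V), IsMaximalOuterplanar G →
      ∀ (E : OuterplanarEmbedding G) (u v w : V), v ≠ w → G.neighborSet u = {v, w} →
      ∀ (H : G.Subgraph), IsSegment E u v w H →
      ∀ (m : GuardModel),
        evc m G ∅ = max (mvcSub H ∅ + 1) (evcSub m H {v, w}) ∧
        evc m G {u} = evcSub m H ∅ + 1 ∧
        evc m G {u, v} = evcSub m H {v} + 1 ∧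
        evc m G {v} = max (mvc G {u, v}) (evc m G ∅) ∧
        ComputesWithin P₁ T
          [mvcSub H ∅, evcSub m H ∅, evcSub m H {v}, evcSub m H {w}, evcSub m H {v, w}]
          [evc m G ∅] ∧
        ComputesWithin P₂ T
          [evc m G ∅, mvc G ∅, mvc G {u}, mvc G {v}, mvc G {u, v},
            evcSub m H ∅, evcSub m H {v}, evcSub m H {w}, evcSub m H {v, w}]
          [evc m G {u}, evc m G {v}, evc m G {u, v}] := by

  refine ⟨maxProgram, remainingProgram, 6, fun V _ G hG E u v w hvw hu H hH m => ?_⟩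
  obtain ⟨hcov, hadj, hseg⟩ := E.structure_of_degree_two hG hvw hu
  obtain rfl := hseg H hH
  obtain ⟨h1, h2, h3, h4⟩ := evc_recurrences m hcov hu hadj
  refine ⟨h1, h2, h3, h4, ?_, ?_⟩
  · rw [h1]
    exact maxProgram_computes _ _ _ _ _
  · rw [h2, h3, h4]
    exact remainingProgram_computes _ _ _ _ _ _ _ _ _
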